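/- **Programs.** Terms are built from numerals $\overline n$ ($n\in\mathbb Z$), symbolic constants, variables and the special symbols $\mathit{inf},\mathit{sup}$ by the binary operations $+,-,\times,/,\backslash,..$ and by $|\cdot|$. Terms without variables are ground; the precomputed terms are the numerals, symbolic constants, $\mathit{inf}$ and $\mathit{sup}$. A total order on ground terms is fixed in which $\mathit{inf}$ is least, $\mathit{sup}$ is greatest, $\overline m<\overline n$ iff $m<n$, and $\overline n<c$ for all numerals $\overline n$ and symbolic constants $c$. Comparisons are $t_1\prec t_2$ with $\prec$ one of $=,\neq,<,>,\le,\ge$; atoms are $p(t_1,\dots,t_n)$ ($n\ge 0$, predicate symbol $p/n$); basic literals are $A$, $not\ A$, $not\ not\ A$ for atoms $A$. A conditional literal is $H:\mathbf L$, where $H$ is a basic literal, a comparison or $\bot$, and $\mathbf L$ is a finite, possibly empty, list of basic literals and comparisons (if $\mathbf L$ is empty, it is identified with $H$). A rule has as head an atom $p(\mathbf t)$ (basic rule), $\{p(\mathbf t)\}$ (choice rule) or $\bot$ (constraint), and as body a finite list $B_1,\dots,B_n$ of conditional literals. A program $\Pi$ is a finite set of rules. A variable is global in $H:\mathbf L$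 if it occurs in $H$ but not in $\mathbf L$; the global variables of a rule are those of its body members and all variables of its head. **Translation $\tau^*$.** The signature $\sigma_\Pi$ has a program sort and a subsort of integers; the precomputed terms as object constants (numerals being of the integer sort); the predicate symbols occurring in $\Pi$ and $<,>,\le,\ge$ as predicate constants with arguments of the program sort; and $+,-,\times,|\cdot|$ on the integer sort. With $I,J,K$ fresh integer variables, $val_t(Z)$ is $Z=t$ for $t$ a numeral, symbolic constant, variable, $\mathit{inf}$ or $\mathit{sup}$; $\exists I(val_{t_1}(I)\wedge Z=|I|)$ for $t=|t_1|$; $\exists IJ(Z=I\circ J\wedge val_{t_1}(I)\wedge val_{t_2}(J))$ for $t=t_1\circ t_2$ with $\circ\in\{+,-,\times\}$; $\exists IJK(val_{t_1}(I)\wedge val_{t_2}(J)\wedge F_1\wedge F_2)$ for $t=t_1/t_2$ and $\exists IJK(val_{t_1}(I)\wedge val_{t_2}(J)\wedge F_1\wedge F_3)$ for $t=t_1\backslash t_2$, where $F_1$ is $K\times|J|\le|I|<(K+\overline 1)\times|J|$, $F_2$ is $(I\times J\ge\overline 0\wedge Z=K)\vee(I\times J<\overline 0\wedge Z=-K)$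 and $F_3$ is $(I\times J\ge\overline 0\wedge Z=I-K\times J)\vee(I\times J<\overline 0\wedge Z=I+K\times J)$; and $\exists IJK(Z=K\wedge I\le K\le J\wedge val_{t_1}(I)\wedge val_{t_2}(J))$ for $t=t_1..t_2$. For a tuple, $val_{\mathbf t}(\mathbf V)$ is the conjunction of the formulas $val_{t_i}(V_i)$. For a set $\mathbf Z$ of variables, $\tau^B_{\mathbf Z}$ sends $\bot$ to $\bot$; $p(\mathbf t)$, $not\ p(\mathbf t)$, $not\ not\ p(\mathbf t)$ to $\exists\mathbf V(val_{\mathbf t}(\mathbf V)\wedge G)$ with $G$ being $p(\mathbf V)$, $\neg p(\mathbf V)$, $\neg\neg p(\mathbf V)$ respectively; $t_1\prec t_2$ to $\exists Z_1Z_2(val_{t_1}(Z_1)\wedge val_{t_2}(Z_2)\wedge Z_1\prec Z_2)$; a list to the conjunction of the translations of its members; and $H:\mathbf L$ with $\mathbf L$ nonempty to $\forall\mathbf X(\tau^B_{\mathbf Z}(\mathbf L)\to\tau^B_{\mathbf Z}(H))$, where $\mathbf X$ are the variables of $H:\mathbf L$ not in $\mathbf Z$. With $\mathbf Z$ the global variables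 of the rule, $\mathbf V$ fresh variables and $\beta=\tau^B_{\mathbf Z}(B_1)\wedge\dots\wedge\tau^B_{\mathbf Z}(B_n)$, $\tau^*$ of a rule with head $p(\mathbf t)$, $\{p(\mathbf t)\}$, $\bot$ is the universal closure of $val_{\mathbf t}(\mathbf V)\wedge\beta\to p(\mathbf V)$, of $val_{\mathbf t}(\mathbf V)\wedge\beta\wedge\neg\neg p(\mathbf V)\to p(\mathbf V)$, and of $\beta\to\bot$, respectively. $\tau^*\Pi$ is the set of the sentences $\tau^*R$ for $R\in\Pi$. **Stable models via SM.** For a list $\mathbf p$ of predicate constants, a $\mathbf p$-stable model of a finite set of sentences with conjunction $F$ is a model of $F\wedge\neg\exists\mathbf u((\mathbf u<\mathbf p)\wedge F^*(\mathbf u))$, where $\mathbf u$ are predicate variables corresponding to $\mathbf p$; $\mathbf u<\mathbf p$ says that $\mathbf u\le\mathbf p$ componentwise as relations and not $\mathbf p\le\mathbf u$; and $F^*$ is obtained by replacing members of $\mathbf p$ in atoms by the corresponding variables, leaving other atoms unchanged, commuting with $\wedge,\vee,\forall,\exists$, and with $(F\to G)^*=(F^*\to G^*)\wedge(F\to G)$.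 An interpretation $\mathcal I$ of $\sigma_\Pi$ is standard if its universes are the set of precomputed terms and the set of numerals, it interprets each precomputed term as itself, interprets $+,-,\times,|\cdot|$ as the corresponding operations on integers, and interprets comparisons by the fixed order. $A(\mathcal I)$ is the set of atoms $p(r_1,\dots,r_n)$ with precomputed arguments that are true in $\mathcal I$. The standard partition $\mathbf p$ consists of all predicate symbols occurring in $\Pi$ (other than comparison symbols). For standard $\mathcal I$, $A(\mathcal I)$ is an *answer set* of $\Pi$ if $\mathcal I$ is a $\mathbf p$-stable model of $\tau^*\Pi$ for this $\mathbf p$. **Gringo answer sets.** The set $[t]$ of values of a ground term is $\{t\}$ for precomputed $t$; $\{\overline{|n|}:\overline n\in[t_1]\}$ for $|t_1|$; the set of $\overline{n_1\circ n_2}$ for $t_1\circ t_2$, $\circ\in\{+,-,\times\}$; the set of $\overline{round(n_1/n_2)}$ with $n_2\ne0$ for $t_1/t_2$; the set of $\overline{n_1-n_2\cdot round(n_1/n_2)}$ with $n_2\neq0$ for $t_1\backslash t_2$; the set of $\overline m$ with $n_1\le m\le n_2$ for $t_1..t_2$; here $\overline{n_i}$ ranges over the numerals in $[t_i]$ and $round$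 is rounding towards $0$. $[\mathbf t]$ is the set of tuples $\mathbf r$ with $r_i\in[t_i]$. The translation $\tau$ to infinitary propositional formulas sends $\bot$ to $\bot$; ground $p(\mathbf t)$, $not\ p(\mathbf t)$, $not\ not\ p(\mathbf t)$ to the disjunction over $\mathbf r\in[\mathbf t]$ of $p(\mathbf r)$, $\neg p(\mathbf r)$, $\neg\neg p(\mathbf r)$ respectively; a ground comparison $t_1\prec t_2$ to $\top$ if $r_1\prec r_2$ for some $r_1\in[t_1]$, $r_2\in[t_2]$, and to $\bot$ otherwise; a list to the conjunction of the translations of its members; a conditional literal $H:\mathbf L$ with $\mathbf L$ nonempty and without global variables, with variables $\mathbf x$, to the conjunction of $\tau(\mathbf L^{\mathbf x}_{\mathbf r})\to\tau(H^{\mathbf x}_{\mathbf r})$ over all tuples $\mathbf r$ of precomputed terms. An instance of a rule is obtained by substituting precomputed terms for all its global variables. For an instance with body translation $\beta$ and head $p(\mathbf t)$, $\{p(\mathbf t)\}$, $\bot$, $\tau$ gives $\beta\to\bigwedge_{\mathbf r\in[\mathbf t]}p(\mathbf r)$, $\beta\to\bigwedge_{\mathbf r\in[\mathbf t]}(p(\mathbf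 r)\vee\neg p(\mathbf r))$, $\neg\beta$ respectively. $\tau R$ is the conjunction of the translations of all instances of $R$, and $\tau\Pi=\{\tau R: R\in\Pi\}$. A set $S$ of precomputed atoms is a *gringo answer set* of $\Pi$ if it is a Truszczyński stable model of $\tau\Pi$, that is, $\langle S,S\rangle$ satisfies $\tau\Pi$ in the infinitary logic of here-and-there and $\langle S_0,S\rangle$ does not for any proper subset $S_0$ of $S$. **Theorem.** Let $\Pi$ be a program and let $\mathcal I$ be a standard interpretation of $\sigma_\Pi$. Then $A(\mathcal I)$ is an answer set of $\Pi$ if and only if $A(\mathcal I)$ is a gringo answer set of $\Pi$. -/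

import Mathlib

namespace CondASP

/-! ## Syntax of logic programs

`Sym` is the set of symbolic constants, `Var` the set of program variables; numerals are the
integers. -/

/-- The binary operation names `+`, `-`, `×`, `/`, `\`, `..`. -/
inductive BinOp : Type
  | add | sub | mul | div | mod | interval

/-- Program terms. -/
inductive Term (Sym Var : Type) : Type
  | num (n : ℤ)
  | sym (c : Sym)
  | var (v : Var)
  | inf
  | sup
  | op (o : BinOp) (t u : Term Sym Var)
  | abs (t : Term Sym Var)

/-- Precomputed terms: numerals, symbolic constants, `inf`, `sup`. -/
inductive Precomputed (Sym : Type) : Type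
  | inf
  | num (n : ℤ)
  | sym (c : Sym)
  | sup

/-- Precomputed terms, seen as program terms. -/
def Precomputed.toTerm {Sym Var : Type} : Precomputed Sym → Term Sym Var
  | .inf => .inf
  | .num n => .num n
  | .sym c => .sym c
  | .sup => .sup

open Classical in
/-- The variables occurring in a term. -/
noncomputable def Term.vars {Sym Var : Type} : Term Sym Var → Finset Var
  | .num _ => ∅
  | .sym _ => ∅
  | .var v => {v}
  | .inf => ∅
  | .sup => ∅
  | .op _ t u => t.vars ∪ u.vars
  | .abs t => t.vars

/-- Ground terms: terms without variables. -/
def GroundTerm (Sym Var : Type) : Type := {t : Term Sym Var // t.vars = ∅}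

/-- Precomputed terms, seen as ground terms. -/
def Precomputed.toGround {Sym Var : Type} (r : Precomputed Sym) : GroundTerm Sym Var :=
  ⟨r.toTerm, by cases r <;> rfl⟩

/-- A total order on ground terms of the kind on which the language is based. -/
structure TermOrder (Sym Var : Type) extends LinearOrder (GroundTerm Sym Var) where
  inf_le : ∀ t : GroundTerm Sym Var, le (Precomputed.inf : Precomputed Sym).toGround t
  le_sup : ∀ t : GroundTerm Sym Var, le t (Precomputed.sup : Precomputed Sym).toGround
  num_lt_num : ∀ m n : ℤ, lt (Precomputed.num m : Precomputed Sym).toGround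
    (Precomputed.num n : Precomputed Sym).toGround ↔ m < n
  num_lt_sym : ∀ (n : ℤ) (c : Sym), lt (Precomputed.num n : Precomputed Sym).toGround
    (Precomputed.sym c : Precomputed Sym).toGround

/-- The comparison symbols `<`, `>`, `≤`, `≥`. -/
inductive OrdRel : Type
  | lt | gt | le | ge

/-- All comparison symbols: `=`, `≠`, and the four order comparisons. -/
inductive Rel : Type
  | eq | ne
  | ord (c : OrdRel)

/-- The relation denoted by an order comparison symbol, on precomputed terms. -/
def TermOrder.holdsOrd {Sym Var : Type} (O : TermOrder Sym Var) :
    OrdRel → Precomputed Sym → Precomputed Sym → Prop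
  | .lt, r, s => O.lt r.toGround s.toGround
  | .gt, r, s => O.lt s.toGround r.toGround
  | .le, r, s => O.le r.toGround s.toGround
  | .ge, r, s => O.le s.toGround r.toGround

/-- The relation denoted by a comparison symbol, on precomputed terms. -/
def TermOrder.holds {Sym Var : Type} (O : TermOrder Sym Var) :
    Rel → Precomputed Sym → Precomputed Sym → Prop
  | .eq, r, s => r = s
  | .ne, r, s => r ≠ s
  | .ord c, r, s => O.holdsOrd c r s

/-- Predicate symbols `p/n`. -/
structure PredSym (Sym : Type) : Type where
  name : Sym
  arity : ℕ

/-- Atoms `p(t₁,…,tₙ)`. -/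
structure Atom (Sym Var : Type) : Type where
  pred : PredSym Sym
  args : Fin pred.arity → Term Sym Var

/-- An atom may be preceded by zero, one or two occurrences of `not`. -/
inductive Sign : Type
  | pos | neg | negneg

/-- Basic literals and comparisons. -/
inductive Lit (Sym Var : Type) : Type
  | basic (s : Sign) (a : Atom Sym Var)
  | cmp (c : Rel) (t u : Term Sym Var)

/-- What may stand before the colon of a conditional literal: a basic literal, a comparison,
or `⊥`. -/
inductive CondHead (Sym Var : Type) : Type
  | lit (l : Lit Sym Var)
  | bot

/-- Conditional literals `H : l₁,…,lₘ`. A basic literal or a comparison is the case `m = 0`. -/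
structure CondLit (Sym Var : Type) : Type where
  head : CondHead Sym Var
  conds : List (Lit Sym Var)

/-- Rule heads: an atom, an atom in braces, or `⊥`. -/
inductive RuleHead (Sym Var : Type) : Type
  | basic (a : Atom Sym Var)
  | choice (a : Atom Sym Var)
  | bot

/-- Rules. -/
structure Rule (Sym Var : Type) : Type where
  head : RuleHead Sym Var
  body : List (CondLit Sym Var)

/-- A program is a finite set of rules. -/
abbrev Program (Sym Var : Type) : Type := Finset (Rule Sym Var)

section Occurrences

variable {Sym Var : Type}

/-! ### Variables and global variables -/

open Classical in
/-- The variables occurring in an atom. -/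
noncomputable def Atom.vars (a : Atom Sym Var) : Finset Var :=
  Finset.univ.biUnion fun i => (a.args i).vars

open Classical in
/-- The variables occurring in a basic literal or comparison. -/
noncomputable def Lit.vars : Lit Sym Var → Finset Var
  | .basic _ a => a.vars
  | .cmp _ t u => t.vars ∪ u.vars

/-- The variables occurring in the part of a conditional literal before the colon. -/
noncomputable def CondHead.vars : CondHead Sym Var → Finset Var
  | .lit l => l.vars
  | .bot => ∅

open Classical in
/-- The variables occurring in a list of literals. -/
noncomputable def litsVars (L : List (Lit Sym Var)) : Finset Var :=
  L.foldr (fun l s => l.vars ∪ s) ∅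

open Classical in
/-- The variables occurring in a conditional literal. -/
noncomputable def CondLit.vars (B : CondLit Sym Var) : Finset Var :=
  B.head.vars ∪ litsVars B.conds

open Classical in
/-- The variables that are global in `H : L`: they occur in `H` but not in `L`. -/
noncomputable def CondLit.globals (B : CondLit Sym Var) : Finset Var :=
  B.head.vars \ litsVars B.conds

/-- The variables occurring in the head of a rule. -/
noncomputable def RuleHead.vars : RuleHead Sym Var → Finset Var
  | .basic a => a.vars
  | .choice a => a.vars
  | .bot => ∅

open Classical in
/-- The global variables of a rule. -/
noncomputable def Rule.globals (R : Rule Sym Var) : Finset Var :=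
  R.head.vars ∪ R.body.foldr (fun B s => B.globals ∪ s) ∅

/-! ### Occurrences of predicate symbols -/

/-- The predicate symbols occurring in a basic literal or comparison. -/
def Lit.preds : Lit Sym Var → Set (PredSym Sym)
  | .basic _ a => {a.pred}
  | .cmp _ _ _ => ∅

/-- The predicate symbols occurring before the colon of a conditional literal. -/
def CondHead.preds : CondHead Sym Var → Set (PredSym Sym)
  | .lit l => l.preds
  | .bot => ∅

/-- The predicate symbols occurring in a conditional literal. -/
def CondLit.preds (B : CondLit Sym Var) : Set (PredSym Sym) :=
  {q | q ∈ B.head.preds ∨ ∃ l ∈ B.conds, q ∈ l.preds}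

/-- The predicate symbols occurring in the head of a rule. -/
def RuleHead.preds : RuleHead Sym Var → Set (PredSym Sym)
  | .basic a => {a.pred}
  | .choice a => {a.pred}
  | .bot => ∅

/-- The predicate symbols occurring in a rule. -/
def Rule.preds (R : Rule Sym Var) : Set (PredSym Sym) :=
  {q | q ∈ R.head.preds ∨ ∃ B ∈ R.body, q ∈ B.preds}

/-- The predicate symbols occurring in a program. -/
def Program.preds (P : Program Sym Var) : Set (PredSym Sym) :=
  {q | ∃ R ∈ P, q ∈ R.preds}

end Occurrences

/-! ## The two-sorted target language

There is a program sort and an integer sort, the latter a subsort of the former. The predicate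
constants, other than comparison symbols, form a type `Q` with an arity function `ar`; all their
arguments are of the program sort. -/

/-- Variables of the program sort: the variables of the logic program, and an infinite supply of
fresh ones. (Variables of the integer sort are numbered by `ℕ`.) -/
inductive PVar (Var : Type) : Type
  | prog (v : Var)
  | fresh (n : ℕ)

/-- Terms of the integer sort. -/
inductive ITm : Type
  | ivar (k : ℕ)
  | num (n : ℤ)
  | add (i j : ITm)
  | sub (i j : ITm)
  | mul (i j : ITm)
  | abs (i : ITm)

/-- Terms of the program sort; a term of the integer sort may be used as one. -/
inductive PTm (Sym Var : Type) : Type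
  | pvar (x : PVar Var)
  | sym (c : Sym)
  | inf
  | sup
  | int (i : ITm)

/-- First-order formulas. `allP`, `exP` quantify over the program sort, `allI`, `exI` over the
integer sort. -/
inductive Fml (Sym Var : Type) {Q : Type} (ar : Q → ℕ) : Type
  | bot
  | pred (q : Q) (ts : Fin (ar q) → PTm Sym Var)
  | cmp (c : OrdRel) (s t : PTm Sym Var)
  | eq (s t : PTm Sym Var)
  | and (F G : Fml Sym Var ar)
  | or (F G : Fml Sym Var ar)
  | imp (F G : Fml Sym Var ar)
  | allP (x : PVar Var) (F : Fml Sym Var ar)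
  | exP (x : PVar Var) (F : Fml Sym Var ar)
  | allI (k : ℕ) (F : Fml Sym Var ar)
  | exI (k : ℕ) (F : Fml Sym Var ar)

/-- An interpretation whose universe of the program sort is `D`. -/
structure Interp (Sym : Type) {Q : Type} (ar : Q → ℕ) (D : Type) : Type where
  /-- the universe of the integer sort -/
  intUniv : Set D
  /-- the object constants -/
  const : Precomputed Sym → D
  /-- numerals are object constants of the integer sort -/
  const_num_mem : ∀ n : ℤ, const (.num n) ∈ intUniv
  add : intUniv → intUniv → intUniv
  sub : intUniv → intUniv → intUniv
  mul : intUniv → intUniv → intUniv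
  abs : intUniv → intUniv
  /-- the comparison symbols other than equality and inequality -/
  cmp : OrdRel → D → D → Prop
  /-- the other predicate constants -/
  pred : (q : Q) → (Fin (ar q) → D) → Prop

section FirstOrder

variable {Sym Var Q : Type} {ar : Q → ℕ} {D : Type}

namespace Fml

/-- Negation is implication of `⊥`. -/
def neg (F : Fml Sym Var ar) : Fml Sym Var ar := .imp F .bot

/-- Truth. -/
def top : Fml Sym Var ar := neg .bot

/-- The conjunction of a list of formulas. -/
def conj : List (Fml Sym Var ar) → Fml Sym Var ar
  | [] => top
  | F :: Fs => .and F (conj Fs)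

/-- Universal quantification over a list of variables of the program sort. -/
def allPs (xs : List (PVar Var)) (F : Fml Sym Var ar) : Fml Sym Var ar := xs.foldr .allP F

/-- Existential quantification over a list of variables of the program sort. -/
def exPs (xs : List (PVar Var)) (F : Fml Sym Var ar) : Fml Sym Var ar := xs.foldr .exP F

/-- The formula `s ≺ t`; here `s ≠ t` is the negation of `s = t`. -/
def rel : Rel → PTm Sym Var → PTm Sym Var → Fml Sym Var ar
  | .eq, s, t => .eq s t
  | .ne, s, t => neg (.eq s t)
  | .ord c, s, t => .cmp c s t

end Fml

/-- The value of a term of the integer sort under an assignment. -/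
def ITm.eval (I : Interp Sym ar D) (ei : ℕ → I.intUniv) : ITm → I.intUniv
  | .ivar k => ei k
  | .num n => ⟨I.const (.num n), I.const_num_mem n⟩
  | .add i j => I.add (i.eval I ei) (j.eval I ei)
  | .sub i j => I.sub (i.eval I ei) (j.eval I ei)
  | .mul i j => I.mul (i.eval I ei) (j.eval I ei)
  | .abs i => I.abs (i.eval I ei)

/-- The value of a term of the program sort under an assignment. -/
def PTm.eval (I : Interp Sym ar D) (ep : PVar Var → D) (ei : ℕ → I.intUniv) :
    PTm Sym Var → D
  | .pvar x => ep x
  | .sym c => I.const (.sym c)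
  | .inf => I.const .inf
  | .sup => I.const .sup
  | .int i => (i.eval I ei : D)

open Classical in
/-- Satisfaction of a formula under an assignment. -/
def Interp.Sat (I : Interp Sym ar D) :
    (PVar Var → D) → (ℕ → I.intUniv) → Fml Sym Var ar → Prop
  | _, _, .bot => False
  | ep, ei, .pred q ts => I.pred q fun i => (ts i).eval I ep ei
  | ep, ei, .cmp c s t => I.cmp c (s.eval I ep ei) (t.eval I ep ei)
  | ep, ei, .eq s t => s.eval I ep ei = t.eval I ep ei
  | ep, ei, .and F G => I.Sat ep ei F ∧ I.Sat ep ei G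
  | ep, ei, .or F G => I.Sat ep ei F ∨ I.Sat ep ei G
  | ep, ei, .imp F G => I.Sat ep ei F → I.Sat ep ei G
  | ep, ei, .allP x F => ∀ d : D, I.Sat (Function.update ep x d) ei F
  | ep, ei, .exP x F => ∃ d : D, I.Sat (Function.update ep x d) ei F
  | ep, ei, .allI k F => ∀ d : I.intUniv, I.Sat ep (Function.update ei k d) F
  | ep, ei, .exI k F => ∃ d : I.intUniv, I.Sat ep (Function.update ei k d) F

/-- `I` is a model of the sentence `F`. -/
def Interp.Models (I : Interp Sym ar D) (F : Fml Sym Var ar) : Prop :=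
  ∀ (ep : PVar Var → D) (ei : ℕ → I.intUniv), I.Sat ep ei F

/-! ### The operator SM -/

/-- The arities of the signature extended by a predicate variable `u_q` for each member `q`
of `p`. -/
def extArity (ar : Q → ℕ) (p : Set Q) : Q ⊕ p → ℕ := Sum.elim ar fun q => ar q

/-- A formula, seen as a formula of the extended signature. -/
def Fml.lift (p : Set Q) : Fml Sym Var ar → Fml Sym Var (extArity ar p)
  | .bot => .bot
  | .pred q ts => .pred (Sum.inl q) ts
  | .cmp c s t => .cmp c s t
  | .eq s t => .eq s t
  | .and F G => .and (F.lift p) (G.lift p)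
  | .or F G => .or (F.lift p) (G.lift p)
  | .imp F G => .imp (F.lift p) (G.lift p)
  | .allP x F => .allP x (F.lift p)
  | .exP x F => .exP x (F.lift p)
  | .allI k F => .allI k (F.lift p)
  | .exI k F => .exI k (F.lift p)

open Classical in
/-- The formula `F*(u)`. -/
noncomputable def Fml.star (p : Set Q) : Fml Sym Var ar → Fml Sym Var (extArity ar p)
  | .bot => .bot
  | .pred q ts => if h : q ∈ p then .pred (Sum.inr ⟨q, h⟩) ts else .pred (Sum.inl q) ts
  | .cmp c s t => .cmp c s t
  | .eq s t => .eq s t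
  | .and F G => .and (F.star p) (G.star p)
  | .or F G => .or (F.star p) (G.star p)
  | .imp F G => .and (.imp (F.star p) (G.star p)) (.imp (F.lift p) (G.lift p))
  | .allP x F => .allP x (F.star p)
  | .exP x F => .exP x (F.star p)
  | .allI k F => .allI k (F.star p)
  | .exI k F => .exI k (F.star p)

/-- The values of the predicate variables `u`. -/
abbrev PredAssign (ar : Q → ℕ) (p : Set Q) (D : Type) : Type :=
  (q : p) → (Fin (ar q) → D) → Prop

/-- The interpretation `I`, extended by values of the predicate variables. -/
abbrev Interp.extend (I : Interp Sym ar D) (p : Set Q) (U : PredAssign ar p D) :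
    Interp Sym (extArity ar p) D where
  intUniv := I.intUniv
  const := I.const
  const_num_mem := I.const_num_mem
  add := I.add
  sub := I.sub
  mul := I.mul
  abs := I.abs
  cmp := I.cmp
  pred
    | .inl q => I.pred q
    | .inr q => U q

/-- `u < p`, that is, `u ≤ p` and not `p ≤ u`. -/
def Interp.PredLT (I : Interp Sym ar D) (p : Set Q) (U : PredAssign ar p D) : Prop :=
  (∀ (q : p) (w : Fin (ar q) → D), U q w → I.pred q w) ∧
    ¬ ∀ (q : p) (w : Fin (ar q) → D), I.pred q w → U q w

/-- `I` is a `p`-stable model of the sentence `F`: it is a model of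
`SM_p[F] = F ∧ ¬∃u ((u < p) ∧ F*(u))`. -/
def Interp.IsStableModel (I : Interp Sym ar D) (p : Set Q) (F : Fml Sym Var ar) : Prop :=
  I.Models F ∧ ¬ ∃ U : PredAssign ar p D, I.PredLT p U ∧ (I.extend p U).Models (F.star p)

/-- The `p`-stable models of a finite list of sentences are those of its conjunction. -/
def Interp.IsStableModelOf (I : Interp Sym ar D) (p : Set Q) (Γ : List (Fml Sym Var ar)) :
    Prop :=
  I.IsStableModel p (Fml.conj Γ)

/-! ## The translation `τ*` -/

/-- `F₁(IJK)`: `K × |J| ≤ |I| < (K + 1) × |J|`. -/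
def quotFml (I J K : ITm) : Fml Sym Var ar :=
  .and (.cmp .le (.int (.mul K (.abs J))) (.int (.abs I)))
    (.cmp .lt (.int (.abs I)) (.int (.mul (.add K (.num 1)) (.abs J))))

/-- `F₂(IJKZ)`: `(I × J ≥ 0 ∧ Z = K) ∨ (I × J < 0 ∧ Z = -K)`. -/
def divFml (I J K : ITm) (Z : PTm Sym Var) : Fml Sym Var ar :=
  .or (.and (.cmp .ge (.int (.mul I J)) (.int (.num 0))) (.eq Z (.int K)))
    (.and (.cmp .lt (.int (.mul I J)) (.int (.num 0))) (.eq Z (.int (.sub (.num 0) K))))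

/-- `F₃(IJKZ)`: `(I × J ≥ 0 ∧ Z = I - K × J) ∨ (I × J < 0 ∧ Z = I + K × J)`. -/
def modFml (I J K : ITm) (Z : PTm Sym Var) : Fml Sym Var ar :=
  .or (.and (.cmp .ge (.int (.mul I J)) (.int (.num 0))) (.eq Z (.int (.sub I (.mul K J)))))
    (.and (.cmp .lt (.int (.mul I J)) (.int (.num 0))) (.eq Z (.int (.add I (.mul K J)))))

/-- The formula `val_t(Z)`. The argument `k` serves to choose fresh integer variables: those
numbered `k` and above do not occur in `Z`. -/
def valFml : Term Sym Var → ℕ → PTm Sym Var → Fml Sym Var ar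
  | .num n, _, Z => .eq Z (.int (.num n))
  | .sym c, _, Z => .eq Z (.sym c)
  | .var v, _, Z => .eq Z (.pvar (.prog v))
  | .inf, _, Z => .eq Z .inf
  | .sup, _, Z => .eq Z .sup
  | .abs t, k, Z =>
      .exI k (.and (valFml t (k + 1) (.int (.ivar k))) (.eq Z (.int (.abs (.ivar k)))))
  | .op .add t u, k, Z =>
      .exI k (.exI (k + 1)
        (.and (.eq Z (.int (.add (.ivar k) (.ivar (k + 1)))))
          (.and (valFml t (k + 2) (.int (.ivar k))) (valFml u (k + 2) (.int (.ivar (k + 1)))))))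
  | .op .sub t u, k, Z =>
      .exI k (.exI (k + 1)
        (.and (.eq Z (.int (.sub (.ivar k) (.ivar (k + 1)))))
          (.and (valFml t (k + 2) (.int (.ivar k))) (valFml u (k + 2) (.int (.ivar (k + 1)))))))
  | .op .mul t u, k, Z =>
      .exI k (.exI (k + 1)
        (.and (.eq Z (.int (.mul (.ivar k) (.ivar (k + 1)))))
          (.and (valFml t (k + 2) (.int (.ivar k))) (valFml u (k + 2) (.int (.ivar (k + 1)))))))
  | .op .div t u, k, Z =>
      .exI k (.exI (k + 1) (.exI (k + 2)
        (.and (valFml t (k + 3) (.int (.ivar k)))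
          (.and (valFml u (k + 3) (.int (.ivar (k + 1))))
            (.and (quotFml (.ivar k) (.ivar (k + 1)) (.ivar (k + 2)))
              (divFml (.ivar k) (.ivar (k + 1)) (.ivar (k + 2)) Z))))))
  | .op .mod t u, k, Z =>
      .exI k (.exI (k + 1) (.exI (k + 2)
        (.and (valFml t (k + 3) (.int (.ivar k)))
          (.and (valFml u (k + 3) (.int (.ivar (k + 1))))
            (.and (quotFml (.ivar k) (.ivar (k + 1)) (.ivar (k + 2)))
              (modFml (.ivar k) (.ivar (k + 1)) (.ivar (k + 2)) Z))))))
  | .op .interval t u, k, Z =>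
      .exI k (.exI (k + 1) (.exI (k + 2)
        (.and (.eq Z (.int (.ivar (k + 2))))
          (.and (.and (.cmp .le (.int (.ivar k)) (.int (.ivar (k + 2))))
              (.cmp .le (.int (.ivar (k + 2))) (.int (.ivar (k + 1)))))
            (.and (valFml t (k + 3) (.int (.ivar k)))
              (valFml u (k + 3) (.int (.ivar (k + 1)))))))))

/-- The list of fresh variables `V₁,…,Vₙ`. -/
def freshVars (Var : Type) (n : ℕ) : List (PVar Var) := List.ofFn fun i : Fin n => .fresh i

/-- The formula `val_t(V)` for a tuple `t` of terms and the tuple `V` of fresh variables. -/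
def valTuple {n : ℕ} (t : Fin n → Term Sym Var) : Fml Sym Var ar :=
  .conj (List.ofFn fun i : Fin n => valFml (t i) 0 (.pvar (.fresh i)))

end FirstOrder

section TauStar

variable {Sym Var : Type}

/-- The arities of a set of predicate symbols. -/
def sigArity (σ : Set (PredSym Sym)) : σ → ℕ := fun q => q.1.arity

/-- The atomic formula `p(V)`, where `V` is the tuple of fresh variables. -/
def freshAtom (σ : Set (PredSym Sym)) (q : PredSym Sym) (h : q ∈ σ) :
    Fml Sym Var (sigArity σ) :=
  .pred ⟨q, h⟩ fun i => .pvar (.fresh i.1)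

/-- A formula preceded by zero, one or two negations. -/
def Sign.toFml {σ : Set (PredSym Sym)} (F : Fml Sym Var (sigArity σ)) :
    Sign → Fml Sym Var (sigArity σ)
  | .pos => F
  | .neg => .neg F
  | .negneg => .neg (.neg F)

/-- `τᴮ` for basic literals and comparisons. -/
def Lit.tauB (σ : Set (PredSym Sym)) : (l : Lit Sym Var) → l.preds ⊆ σ → Fml Sym Var (sigArity σ)
  | .basic s a, h =>
      .exPs (freshVars Var a.pred.arity)
        (.and (valTuple a.args) (s.toFml (freshAtom σ a.pred (h rfl))))
  | .cmp c t u, _ =>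
      .exP (.fresh 0) (.exP (.fresh 1)
        (.and (valFml t 0 (.pvar (.fresh 0)))
          (.and (valFml u 0 (.pvar (.fresh 1)))
            (.rel c (.pvar (.fresh 0)) (.pvar (.fresh 1))))))

/-- `τᴮ` for what stands before the colon of a conditional literal. -/
def CondHead.tauB (σ : Set (PredSym Sym)) :
    (H : CondHead Sym Var) → H.preds ⊆ σ → Fml Sym Var (sigArity σ)
  | .lit l, h => l.tauB σ h
  | .bot, _ => .bot

/-- `τᴮ` for lists of basic literals and comparisons. -/
def litsTauB (σ : Set (PredSym Sym)) (L : List (Lit Sym Var)) (h : ∀ l ∈ L, l.preds ⊆ σ) :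
    Fml Sym Var (sigArity σ) :=
  .conj (L.pmap (fun l hl => l.tauB σ hl) h)

open Classical in
/-- `τᴮ_Z` for conditional literals. If the list of conditions is empty then the conditional
literal is just a basic literal, a comparison or `⊥`, and is translated as such. -/
noncomputable def CondLit.tauB (σ : Set (PredSym Sym)) (Z : Finset Var) (B : CondLit Sym Var)
    (h : B.preds ⊆ σ) : Fml Sym Var (sigArity σ) :=
  if B.conds = [] then B.head.tauB σ fun _ hq => h (Or.inl hq)
  else
    .allPs ((B.vars \ Z).toList.map .prog)
      (.imp (litsTauB σ B.conds fun l hl _ hq => h (Or.inr ⟨l, hl, hq⟩))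
        (B.head.tauB σ fun _ hq => h (Or.inl hq)))

/-- The conjunction of the formulas `τᴮ_Z(B)` for the members `B` of the body of a rule, where
`Z` is the list of global variables of the rule. -/
noncomputable def Rule.tauBody (σ : Set (PredSym Sym)) (R : Rule Sym Var) (h : R.preds ⊆ σ) :
    Fml Sym Var (sigArity σ) :=
  .conj (R.body.pmap (fun B hB => B.tauB σ R.globals hB)
    fun B hB _ hq => h (Or.inr ⟨B, hB, hq⟩))

/-- `τ*` for rules. The free variables of the formula to which the universal closure is applied
are the global variables of the rule and the fresh variables `V`. -/
noncomputable def Rule.tauStar (σ : Set (PredSym Sym)) :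
    (R : Rule Sym Var) → R.preds ⊆ σ → Fml Sym Var (sigArity σ)
  | ⟨.basic a, Bs⟩, h =>
      let R : Rule Sym Var := ⟨.basic a, Bs⟩
      .allPs (freshVars Var a.pred.arity ++ R.globals.toList.map .prog)
        (.imp (.and (valTuple a.args) (R.tauBody σ h))
          (freshAtom σ a.pred (h (Or.inl rfl))))
  | ⟨.choice a, Bs⟩, h =>
      let R : Rule Sym Var := ⟨.choice a, Bs⟩
      .allPs (freshVars Var a.pred.arity ++ R.globals.toList.map .prog)
        (.imp (.and (.and (valTuple a.args) (R.tauBody σ h))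
            (.neg (.neg (freshAtom σ a.pred (h (Or.inl rfl))))))
          (freshAtom σ a.pred (h (Or.inl rfl))))
  | ⟨.bot, Bs⟩, h =>
      let R : Rule Sym Var := ⟨.bot, Bs⟩
      .allPs (R.globals.toList.map .prog) (.imp (R.tauBody σ h) .bot)

/-- The theory `τ*Π`, over the signature `σ_Π`. -/
noncomputable def Program.tauStar (P : Program Sym Var) :
    List (Fml Sym Var (sigArity (Program.preds P))) :=
  P.attach.toList.map fun R => R.1.tauStar (Program.preds P) fun _ hq => ⟨R.1, R.2, hq⟩

end TauStar

/-! ## Standard interpretations and answer sets -/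

/-- Precomputed atoms `p(r₁,…,rₙ)`. -/
structure PAtom (Sym : Type) : Type where
  pred : PredSym Sym
  args : Fin pred.arity → Precomputed Sym

section AnswerSets

variable {Sym Var : Type}

/-- Standard interpretations. That the universe of the program sort is the set of all precomputed
terms is expressed by the type of `I`. -/
structure Interp.IsStandard {Q : Type} {ar : Q → ℕ} (I : Interp Sym ar (Precomputed Sym))
    (O : TermOrder Sym Var) : Prop where
  intUniv_eq : I.intUniv = Set.range Precomputed.num
  const_eq : ∀ r : Precomputed Sym, I.const r = r
  add_eq : ∀ (x y : I.intUniv) (m n : ℤ), (x : Precomputed Sym) = .num m →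
    (y : Precomputed Sym) = .num n → (I.add x y : Precomputed Sym) = .num (m + n)
  sub_eq : ∀ (x y : I.intUniv) (m n : ℤ), (x : Precomputed Sym) = .num m →
    (y : Precomputed Sym) = .num n → (I.sub x y : Precomputed Sym) = .num (m - n)
  mul_eq : ∀ (x y : I.intUniv) (m n : ℤ), (x : Precomputed Sym) = .num m →
    (y : Precomputed Sym) = .num n → (I.mul x y : Precomputed Sym) = .num (m * n)
  abs_eq : ∀ (x : I.intUniv) (n : ℤ), (x : Precomputed Sym) = .num n →
    (I.abs x : Precomputed Sym) = .num |n|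
  cmp_iff : ∀ (c : OrdRel) (r s : Precomputed Sym), I.cmp c r s ↔ O.holdsOrd c r s

/-- `A(I)`: the set of precomputed atoms to which `I` assigns the value true. -/
def Interp.atoms {σ : Set (PredSym Sym)} (I : Interp Sym (sigArity σ) (Precomputed Sym)) :
    Set (PAtom Sym) :=
  {a | ∃ h : a.pred ∈ σ, I.pred ⟨a.pred, h⟩ a.args}

/-- Interpretations of the signature `σ_Π` in the universe of precomputed terms. -/
abbrev Program.Interp (P : Program Sym Var) : Type :=
  CondASP.Interp Sym (sigArity (Program.preds P)) (Precomputed Sym)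

/-- For a standard interpretation `I` of `σ_Π`: `A(I)` is a `p`-answer set of `Π`, that is, `I` is
a `p`-stable model of `τ*Π`. -/
def Program.IsPAnswerSet (P : Program Sym Var) (p : Set (Program.preds P))
    (I : Program.Interp P) : Prop :=
  I.IsStableModelOf p (Program.tauStar P)

/-- The standard partition, identified with its intensional part `p`: all predicate symbols
occurring in `Π` (comparison symbols are not among them). -/
def Program.standardPartition (P : Program Sym Var) : Set (Program.preds P) := Set.univ

/-- For a standard interpretation `I` of `σ_Π`: `A(I)` is an answer set of `Π`. -/
def Program.IsAnswerSet (P : Program Sym Var) (I : Program.Interp P) : Prop :=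
  Program.IsPAnswerSet P (Program.standardPartition P) I

end AnswerSets

/-! ## Infinitary propositional formulas -/

/-- Infinitary propositional formulas over the set `A` of atoms. A conjunction or disjunction of
a set of formulas is given by a family of formulas that lists the members of the set. -/
inductive IFml (A : Type) : Type 1
  | atom (a : A)
  | conj {ι : Type} (f : ι → IFml A)
  | disj {ι : Type} (f : ι → IFml A)
  | imp (P P' : IFml A)

namespace IFml

variable {A : Type}

/-- Truth: the empty conjunction. -/
def top : IFml A := conj (Empty.elim : Empty → IFml A)

/-- Falsity: the empty disjunction. -/
def bot : IFml A := disj (Empty.elim : Empty → IFml A)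

/-- Negation. -/
def neg (P : IFml A) : IFml A := imp P bot

/-- The disjunction of two formulas. -/
def or (P P' : IFml A) : IFml A := disj fun b : Bool => if b then P else P'

/-- The conjunction of a list of formulas. -/
def conjList (L : List (IFml A)) : IFml A := conj fun i : Fin L.length => L.get i

/-- Satisfaction by a propositional interpretation. -/
def Sat (S : Set A) : IFml A → Prop
  | atom a => a ∈ S
  | conj f => ∀ i, (f i).Sat S
  | disj f => ∃ i, (f i).Sat S
  | imp P P' => ¬ P.Sat S ∨ P'.Sat S

/-- Satisfaction by the HT-interpretation `⟨S, S'⟩`, where `S ⊆ S'`. -/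
def HTSat (S S' : Set A) : IFml A → Prop
  | atom a => a ∈ S
  | conj f => ∀ i, (f i).HTSat S S'
  | disj f => ∃ i, (f i).HTSat S S'
  | imp P P' => (imp P P').Sat S' ∧ (¬ P.HTSat S S' ∨ P'.HTSat S S')

/-- `⟨S, S'⟩` is an HT-model of a set of formulas. -/
def HTModel (S S' : Set A) (H : Set (IFml A)) : Prop := ∀ P ∈ H, P.HTSat S S'

/-- `S` is a Truszczyński stable model of a set of formulas: `⟨S, S⟩` is an equilibrium model. -/
def IsTruszczynskiStable (S : Set A) (H : Set (IFml A)) : Prop :=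
  HTModel S S H ∧ ∀ S₀ : Set A, S₀ ⊂ S → ¬ HTModel S₀ S H

end IFml

/-! ## The translation `τ` -/

/-- Rounding towards zero. -/
def roundZero (x : ℚ) : ℤ := if 0 ≤ x then ⌊x⌋ else ⌈x⌉

section Tau

variable {Sym Var : Type}

/-- The set `[t]` of values of a ground term. (A variable is given no value; the definition is
applied to ground terms only.) -/
def Term.vals : Term Sym Var → Set (Precomputed Sym)
  | .num n => {.num n}
  | .sym c => {.sym c}
  | .var _ => ∅
  | .inf => {.inf}
  | .sup => {.sup}
  | .abs t => {r | ∃ n : ℤ, .num n ∈ t.vals ∧ r = .num |n|}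
  | .op .add t u => {r | ∃ m n : ℤ, .num m ∈ t.vals ∧ .num n ∈ u.vals ∧ r = .num (m + n)}
  | .op .sub t u => {r | ∃ m n : ℤ, .num m ∈ t.vals ∧ .num n ∈ u.vals ∧ r = .num (m - n)}
  | .op .mul t u => {r | ∃ m n : ℤ, .num m ∈ t.vals ∧ .num n ∈ u.vals ∧ r = .num (m * n)}
  | .op .div t u => {r | ∃ m n : ℤ, .num m ∈ t.vals ∧ .num n ∈ u.vals ∧ n ≠ 0 ∧
      r = .num (roundZero ((m : ℚ) / (n : ℚ)))}
  | .op .mod t u => {r | ∃ m n : ℤ, .num m ∈ t.vals ∧ .num n ∈ u.vals ∧ n ≠ 0 ∧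
      r = .num (m - n * roundZero ((m : ℚ) / (n : ℚ)))}
  | .op .interval t u => {r | ∃ l m n : ℤ, .num m ∈ t.vals ∧ .num n ∈ u.vals ∧
      m ≤ l ∧ l ≤ n ∧ r = .num l}

/-- The set `[t]` for a tuple of ground terms. -/
def tupleVals {n : ℕ} (t : Fin n → Term Sym Var) : Set (Fin n → Precomputed Sym) :=
  {r | ∀ i, r i ∈ (t i).vals}

/-! ### Substitution of precomputed terms for the variables in a set `X`

A tuple of precomputed terms for the variables in `X` is given by a function on all variables;
only its values on `X` matter. -/

open Classical in
/-- Substitution in terms. -/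
noncomputable def Term.subst (X : Finset Var) (ρ : Var → Precomputed Sym) :
    Term Sym Var → Term Sym Var
  | .num n => .num n
  | .sym c => .sym c
  | .var v => if v ∈ X then (ρ v).toTerm else .var v
  | .inf => .inf
  | .sup => .sup
  | .op o t u => .op o (t.subst X ρ) (u.subst X ρ)
  | .abs t => .abs (t.subst X ρ)

/-- Substitution in atoms. -/
noncomputable def Atom.subst (X : Finset Var) (ρ : Var → Precomputed Sym) (a : Atom Sym Var) :
    Atom Sym Var :=
  ⟨a.pred, fun i => (a.args i).subst X ρ⟩

/-- Substitution in basic literals and comparisons. -/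
noncomputable def Lit.subst (X : Finset Var) (ρ : Var → Precomputed Sym) :
    Lit Sym Var → Lit Sym Var
  | .basic s a => .basic s (a.subst X ρ)
  | .cmp c t u => .cmp c (t.subst X ρ) (u.subst X ρ)

/-- Substitution in what stands before the colon of a conditional literal. -/
noncomputable def CondHead.subst (X : Finset Var) (ρ : Var → Precomputed Sym) :
    CondHead Sym Var → CondHead Sym Var
  | .lit l => .lit (l.subst X ρ)
  | .bot => .bot

/-- Substitution in conditional literals. -/
noncomputable def CondLit.subst (X : Finset Var) (ρ : Var → Precomputed Sym)
    (B : CondLit Sym Var) : CondLit Sym Var :=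
  ⟨B.head.subst X ρ, B.conds.map fun l => l.subst X ρ⟩

/-- Substitution in rule heads. -/
noncomputable def RuleHead.subst (X : Finset Var) (ρ : Var → Precomputed Sym) :
    RuleHead Sym Var → RuleHead Sym Var
  | .basic a => .basic (a.subst X ρ)
  | .choice a => .choice (a.subst X ρ)
  | .bot => .bot

/-- Substitution in rules. -/
noncomputable def Rule.subst (X : Finset Var) (ρ : Var → Precomputed Sym) (R : Rule Sym Var) :
    Rule Sym Var :=
  ⟨R.head.subst X ρ, R.body.map fun B => B.subst X ρ⟩

/-- The instance of a rule that is obtained by substituting the precomputed terms `ρ` for its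
global variables. -/
noncomputable def Rule.inst (R : Rule Sym Var) (ρ : Var → Precomputed Sym) : Rule Sym Var :=
  R.subst R.globals ρ

/-! ### The translation of closed expressions -/

/-- A formula preceded by zero, one or two negations. -/
def Sign.toIFml (P : IFml (PAtom Sym)) : Sign → IFml (PAtom Sym)
  | .pos => P
  | .neg => .neg P
  | .negneg => .neg (.neg P)

open Classical in
/-- `τ` for ground basic literals and ground comparisons. -/
noncomputable def Lit.tau (O : TermOrder Sym Var) : Lit Sym Var → IFml (PAtom Sym)
  | .basic s a => .disj fun r : tupleVals a.args => s.toIFml (.atom ⟨a.pred, r.1⟩)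
  | .cmp c t u => if ∃ r ∈ t.vals, ∃ s ∈ u.vals, O.holds c r s then .top else .bot

/-- `τ` for what stands before the colon of a conditional literal. -/
noncomputable def CondHead.tau (O : TermOrder Sym Var) : CondHead Sym Var → IFml (PAtom Sym)
  | .lit l => l.tau O
  | .bot => .bot

/-- `τ` for lists of ground literals. -/
noncomputable def litsTau (O : TermOrder Sym Var) (L : List (Lit Sym Var)) :
    IFml (PAtom Sym) :=
  .conjList (L.map fun l => l.tau O)

open Classical in
/-- `τ` for closed conditional literals. If the list of conditions is empty then the conditional
literal is just a basic literal, a comparison or `⊥`, and is translated as such. -/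
noncomputable def CondLit.tau (O : TermOrder Sym Var) (B : CondLit Sym Var) :
    IFml (PAtom Sym) :=
  if B.conds = [] then B.head.tau O
  else
    .conj fun ρ : Var → Precomputed Sym =>
      .imp (litsTau O (B.subst B.vars ρ).conds) ((B.subst B.vars ρ).head.tau O)

/-- `τ` for the body of a closed rule. -/
noncomputable def bodyTau (O : TermOrder Sym Var) (L : List (CondLit Sym Var)) :
    IFml (PAtom Sym) :=
  .conjList (L.map fun B => B.tau O)

/-- `τ` for closed rules. -/
noncomputable def Rule.tauClosed (O : TermOrder Sym Var) : Rule Sym Var → IFml (PAtom Sym)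
  | ⟨.basic a, Bs⟩ =>
      .imp (bodyTau O Bs) (.conj fun r : tupleVals a.args => .atom ⟨a.pred, r.1⟩)
  | ⟨.choice a, Bs⟩ =>
      .imp (bodyTau O Bs) (.conj fun r : tupleVals a.args =>
        .or (.atom ⟨a.pred, r.1⟩) (.neg (.atom ⟨a.pred, r.1⟩)))
  | ⟨.bot, Bs⟩ => .neg (bodyTau O Bs)

/-- `τ` for arbitrary rules: the conjunction over all instances. -/
noncomputable def Rule.tau (O : TermOrder Sym Var) (R : Rule Sym Var) : IFml (PAtom Sym) :=
  .conj fun ρ : Var → Precomputed Sym => (R.inst ρ).tauClosed O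

/-- `τ` for programs. -/
def Program.tau (O : TermOrder Sym Var) (P : Program Sym Var) : Set (IFml (PAtom Sym)) :=
  {F | ∃ R ∈ P, F = Rule.tau O R}

/-- `S` is a gringo answer set of the program. -/
def Program.IsGringoAnswerSet (O : TermOrder Sym Var) (P : Program Sym Var)
    (S : Set (PAtom Sym)) : Prop :=
  IFml.IsTruszczynskiStable S (Program.tau O P)

end Tau

end CondASP

open CondASP

/-! Both notions of answer set are equilibrium conditions in the logic of here-and-there, one for
first-order and one for infinitary propositional formulas; the theorem holds because the two
translations of a rule have the same here-and-there models.

On the first-order side every predicate symbol is intensional, and `(F → G)* = (F* → G*) ∧ (F → G)`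
is precisely the here-and-there clause for implication. Hence `F*(u)` says that the pair with `u` as
the world of here and `I` as the world of there satisfies `F` (`Interp.sat_star_univ`). Stability
then means that `I` is a model and that no strictly smaller `u` gives such a pair.

For the comparison of translations, a standard interpretation lets program variables range over
precomputed terms. Universal closures thus become conjunctions over instances, and `∃V (val_t(V) ∧
…)` becomes a disjunction over `[t]`, since `val_t(Z)` defines membership in `[t]`
(`Interp.ht_valFml`). Following this correspondence through literals, conditional literals and rules
yields `Interp.ht_tauStar`: the pair `(V, I)` satisfies `τ*R` iff the pair of sets of atoms true in
`V` and in `I` satisfies `τR`.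

Finally, the relation families `u < p` correspond to the proper subsets of `A(I)`
(`Interp.predLT_univ_iff`, `exists_atomsOf_eq`), so the two minimality conditions range over the
same competitors. -/

namespace CondASP

/-! ### Infinitary propositional here-and-there logic -/

namespace IFml

variable {A : Type}

theorem htSat_self (S : Set A) (F : IFml A) : F.HTSat S S ↔ F.Sat S := by
  induction F with
  | atom a => rfl
  | conj f ih => exact forall_congr' ih
  | disj f ih => exact exists_congr ih
  | imp P P' ih ih' => simp only [HTSat, Sat, ih, ih', and_self]

/-- Writing the classical condition at `S'` as satisfaction by the pair `(S', S')` puts both worlds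
in one format, so that an equivalence proved for arbitrary pairs can be used for both halves of an
implication. -/
theorem htSat_imp (S S' : Set A) (P P' : IFml A) :
    (imp P P').HTSat S S' ↔
      (P.HTSat S' S' → P'.HTSat S' S') ∧ (P.HTSat S S' → P'.HTSat S S') := by
  simp only [HTSat, Sat, htSat_self, imp_iff_not_or]

@[simp] theorem htSat_top (S S' : Set A) : (top : IFml A).HTSat S S' :=
  fun i => i.elim

@[simp] theorem not_htSat_bot (S S' : Set A) : ¬ (bot : IFml A).HTSat S S' :=
  fun ⟨i, _⟩ => i.elim

/-- Moves the conjunction over the values `r ∈ [t]` of a rule head in front of the rule, where it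
matches the quantifiers `∀V` of `τ*`. -/
theorem htSat_imp_conj (S S' : Set A) (P : IFml A) {ι : Type} (f : ι → IFml A) :
    (imp P (conj f)).HTSat S S' ↔ ∀ i, (imp P (f i)).HTSat S S' := by
  simp only [htSat_imp]
  exact ⟨fun h i => ⟨fun hP => h.1 hP i, fun hP => h.2 hP i⟩,
    fun h => ⟨fun hP i => (h i).1 hP, fun hP i => (h i).2 hP⟩⟩

theorem htSat_neg (S S' : Set A) (P : IFml A) :
    (neg P).HTSat S S' ↔ ¬ P.HTSat S' S' ∧ ¬ P.HTSat S S' := by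
  simp only [neg, htSat_imp, not_htSat_bot, imp_false]

theorem htSat_or (S S' : Set A) (P P' : IFml A) :
    (or P P').HTSat S S' ↔ P.HTSat S S' ∨ P'.HTSat S S' := by
  simp [or, HTSat, or_comm]

theorem htSat_conjList (S S' : Set A) (L : List (IFml A)) :
    (conjList L).HTSat S S' ↔ ∀ P ∈ L, P.HTSat S S' := by
  refine ⟨fun h P hP => ?_, fun h i => h _ (List.get_mem L i)⟩
  obtain ⟨i, rfl⟩ := List.get_of_mem hP
  exact h i

end IFml

/-! ### First-order here-and-there logic and the operator SM -/

section HereAndThere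

variable {Sym Var Q : Type} {ar : Q → ℕ} {D : Type}

open Classical in
/-- Satisfaction in the first-order logic of here-and-there: `I` is the world of there, and `V`
interprets the predicate constants in the world of here. -/
def Interp.HT (I : Interp Sym ar D) (V : (q : Q) → (Fin (ar q) → D) → Prop) :
    (PVar Var → D) → (ℕ → I.intUniv) → Fml Sym Var ar → Prop
  | _, _, .bot => False
  | ep, ei, .pred q ts => V q fun i => (ts i).eval I ep ei
  | ep, ei, .cmp c s t => I.cmp c (s.eval I ep ei) (t.eval I ep ei)
  | ep, ei, .eq s t => s.eval I ep ei = t.eval I ep ei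
  | ep, ei, .and F G => I.HT V ep ei F ∧ I.HT V ep ei G
  | ep, ei, .or F G => I.HT V ep ei F ∨ I.HT V ep ei G
  | ep, ei, .imp F G => (I.HT V ep ei F → I.HT V ep ei G) ∧ I.Sat ep ei (.imp F G)
  | ep, ei, .allP x F => ∀ d : D, I.HT V (Function.update ep x d) ei F
  | ep, ei, .exP x F => ∃ d : D, I.HT V (Function.update ep x d) ei F
  | ep, ei, .allI k F => ∀ d : I.intUniv, I.HT V ep (Function.update ei k d) F
  | ep, ei, .exI k F => ∃ d : I.intUniv, I.HT V ep (Function.update ei k d) F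

namespace Interp

variable (I : Interp Sym ar D) (V : (q : Q) → (Fin (ar q) → D) → Prop)

theorem ht_self (ep : PVar Var → D) (ei : ℕ → I.intUniv) (F : Fml Sym Var ar) :
    I.HT I.pred ep ei F ↔ I.Sat ep ei F := by
  induction F generalizing ep ei with
  | bot => rfl
  | pred | cmp | eq => rfl
  | and F G ih ih' | or F G ih ih' | imp F G ih ih' => simp [HT, Sat, ih, ih']
  | allP x F ih | exP x F ih | allI x F ih | exI x F ih => simp [HT, Sat, ih]

/-- First-order counterpart of `IFml.htSat_imp`: the world of there is again an instance of `HT`,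
with `V := I.pred`. -/
theorem ht_imp (ep : PVar Var → D) (ei : ℕ → I.intUniv) (F G : Fml Sym Var ar) :
    I.HT V ep ei (.imp F G) ↔ (I.HT I.pred ep ei F → I.HT I.pred ep ei G) ∧
      (I.HT V ep ei F → I.HT V ep ei G) := by
  simp only [HT, Sat, ht_self, and_comm]

theorem ht_neg (ep : PVar Var → D) (ei : ℕ → I.intUniv) (F : Fml Sym Var ar) :
    I.HT V ep ei F.neg ↔ ¬ I.HT I.pred ep ei F ∧ ¬ I.HT V ep ei F := by
  simp only [Fml.neg, ht_imp, HT, imp_false]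

theorem ht_conj (ep : PVar Var → D) (ei : ℕ → I.intUniv) (L : List (Fml Sym Var ar)) :
    I.HT V ep ei (.conj L) ↔ ∀ F ∈ L, I.HT V ep ei F := by
  induction L with
  | nil => simp [Fml.conj, Fml.top, ht_neg, HT]
  | cons F L ih => simp [Fml.conj, HT, ih]

theorem ht_exPs (ep : PVar Var → D) (ei : ℕ → I.intUniv) (xs : List (PVar Var))
    (F : Fml Sym Var ar) :
    I.HT V ep ei (.exPs xs F) ↔
      ∃ ep' : PVar Var → D, (∀ x ∉ xs, ep' x = ep x) ∧ I.HT V ep' ei F := by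
  classical
  induction xs generalizing ep with
  | nil =>
    refine ⟨fun h => ⟨ep, fun _ _ => rfl, h⟩, fun ⟨ep', h, hF⟩ => ?_⟩
    obtain rfl : ep' = ep := funext fun x => h x List.not_mem_nil
    exact hF
  | cons y xs ih =>
    simp only [Fml.exPs, List.foldr_cons, HT] at ih ⊢
    constructor
    · rintro ⟨d, h⟩
      obtain ⟨ep', h, hF⟩ := (ih _).1 h
      refine ⟨ep', fun x hx => ?_, hF⟩
      rw [List.mem_cons, not_or] at hx
      rw [h x hx.2, Function.update_of_ne hx.1]
    · rintro ⟨ep', h, hF⟩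
      -- The outer witness is the final value of `y`. If `y` occurs again in `xs`, the inner
      -- quantifiers override it anyway.
      refine ⟨ep' y, (ih _).2 ⟨ep', fun x hx => ?_, hF⟩⟩
      by_cases hxy : x = y
      · subst hxy; simp
      · rw [Function.update_of_ne hxy, h x (by simp [hxy, hx])]

theorem ht_allPs (ep : PVar Var → D) (ei : ℕ → I.intUniv) (xs : List (PVar Var))
    (F : Fml Sym Var ar) :
    I.HT V ep ei (.allPs xs F) ↔
      ∀ ep' : PVar Var → D, (∀ x ∉ xs, ep' x = ep x) → I.HT V ep' ei F := by
  classical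
  induction xs generalizing ep with
  | nil =>
    refine ⟨fun h ep' h' => ?_, fun h => h ep fun _ _ => rfl⟩
    obtain rfl : ep' = ep := funext fun x => h' x List.not_mem_nil
    exact h
  | cons y xs ih =>
    simp only [Fml.allPs, List.foldr_cons, HT] at ih ⊢
    constructor
    · intro h ep' h'
      refine (ih _).1 (h (ep' y)) ep' fun x hx => ?_
      by_cases hxy : x = y
      · subst hxy; simp
      · rw [Function.update_of_ne hxy, h' x (by simp [hxy, hx])]
    · intro h d
      refine (ih _).2 fun ep' h' => h ep' fun x hx => ?_
      rw [List.mem_cons, not_or] at hx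
      rw [h' x hx.2, Function.update_of_ne hx.1]

theorem itm_eval_extend (p : Set Q) (U : PredAssign ar p D) (ei : ℕ → I.intUniv) (i : ITm) :
    i.eval (I.extend p U) ei = i.eval I ei := by
  induction i with
  | ivar | num => rfl
  | add _ _ ih ih' | sub _ _ ih ih' | mul _ _ ih ih' => simp only [ITm.eval, ih, ih']
  | abs _ ih => simp only [ITm.eval, ih]

theorem ptm_eval_extend (p : Set Q) (U : PredAssign ar p D) (ep : PVar Var → D)
    (ei : ℕ → I.intUniv) (t : PTm Sym Var) :
    t.eval (I.extend p U) ep ei = t.eval I ep ei := by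
  cases t with
  | int i => exact congrArg Subtype.val (itm_eval_extend I p U ei i)
  | _ => rfl

/-- A lifted formula does not mention the predicate variables, so their values are irrelevant. -/
theorem sat_lift (p : Set Q) (U : PredAssign ar p D) (ep : PVar Var → D)
    (ei : ℕ → I.intUniv) (F : Fml Sym Var ar) :
    (I.extend p U).Sat ep ei (F.lift p) ↔ I.Sat ep ei F := by
  induction F generalizing ep ei with
  | bot => rfl
  | pred q ts =>
    simp only [Fml.lift, Sat]
    exact iff_of_eq (congrArg (I.pred q) (funext fun i => ptm_eval_extend I p U ep ei (ts i)))
  | cmp | eq => simp only [Fml.lift, Sat, ptm_eval_extend]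
  | and F G ih ih' | or F G ih ih' | imp F G ih ih' => simp only [Fml.lift, Sat, ih, ih']
  | allP x F ih | exP x F ih | allI x F ih | exI x F ih => simp only [Fml.lift, Sat, ih]

/-- With all predicate symbols intensional, every starred atom is read in `U`. For an implication,
the starred conjunct is the condition here and the lifted conjunct, by `sat_lift`, is the classical
condition there. -/
theorem sat_star_univ (U : PredAssign ar (Set.univ : Set Q) D) (ep : PVar Var → D)
    (ei : ℕ → I.intUniv) (F : Fml Sym Var ar) :
    (I.extend Set.univ U).Sat ep ei (F.star Set.univ) ↔
      I.HT (fun q => U ⟨q, trivial⟩) ep ei F := by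
  induction F generalizing ep ei with
  | bot => rfl
  | pred q ts =>
    simp only [Fml.star, Set.mem_univ, dif_pos, Sat, HT]
    exact iff_of_eq (congrArg (U ⟨q, trivial⟩)
      (funext fun i => ptm_eval_extend I Set.univ U ep ei (ts i)))
  | cmp | eq => simp only [Fml.star, Sat, HT, ptm_eval_extend]
  | imp F G ih ih' => simp only [Fml.star, Sat, HT, ih, ih', sat_lift]
  | and F G ih ih' | or F G ih ih' => simp only [Fml.star, Sat, HT, ih, ih']
  | allP x F ih | exP x F ih | allI x F ih | exI x F ih => simp only [Fml.star, Sat, HT, ih]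

end Interp

end HereAndThere

/-! ### Substitution of precomputed terms -/

section Substitution

variable {Sym Var : Type}

@[simp] theorem Precomputed.vars_toTerm (r : Precomputed Sym) :
    (r.toTerm : Term Sym Var).vars = ∅ := by
  cases r <;> rfl

@[simp] theorem Precomputed.subst_toTerm (X : Finset Var) (ρ : Var → Precomputed Sym)
    (r : Precomputed Sym) : (r.toTerm : Term Sym Var).subst X ρ = r.toTerm := by
  cases r <;> rfl

@[simp] theorem Precomputed.vals_toTerm (r : Precomputed Sym) :
    (r.toTerm : Term Sym Var).vals = {r} := by
  cases r <;> rfl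

open Classical in
theorem Term.vars_subst (X : Finset Var) (ρ : Var → Precomputed Sym) (t : Term Sym Var) :
    (t.subst X ρ).vars = t.vars \ X := by
  induction t with
  | var v =>
    by_cases h : v ∈ X
    · simp [subst, vars, h, Finset.sdiff_eq_empty_iff_subset.2]
    · simp [subst, vars, h, Finset.sdiff_eq_self_of_disjoint]
  | op o t u ih ih' => simp only [subst, vars, ih, ih', Finset.union_sdiff_distrib]
  | abs t ih => simpa only [subst, vars] using ih
  | _ => simp [subst, vars]

theorem Atom.mem_vars {a : Atom Sym Var} {v : Var} : v ∈ a.vars ↔ ∃ i, v ∈ (a.args i).vars := by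
  simp [Atom.vars]

open Classical in
theorem Atom.vars_subst (X : Finset Var) (ρ : Var → Precomputed Sym) (a : Atom Sym Var) :
    (a.subst X ρ).vars = a.vars \ X := by
  ext v
  simp only [Atom.mem_vars, Atom.subst, Term.vars_subst, Finset.mem_sdiff, exists_and_right]

open Classical in
theorem Lit.vars_subst (X : Finset Var) (ρ : Var → Precomputed Sym) (l : Lit Sym Var) :
    (l.subst X ρ).vars = l.vars \ X := by
  cases l with
  | basic s a => exact a.vars_subst X ρ
  | cmp c t u => simp only [Lit.subst, Lit.vars, Term.vars_subst, Finset.union_sdiff_distrib]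

open Classical in
theorem CondHead.vars_subst (X : Finset Var) (ρ : Var → Precomputed Sym)
    (H : CondHead Sym Var) : (H.subst X ρ).vars = H.vars \ X := by
  cases H with
  | lit l => exact l.vars_subst X ρ
  | bot => simp [CondHead.subst, CondHead.vars]

open Classical in
theorem mem_litsVars {L : List (Lit Sym Var)} {v : Var} :
    v ∈ litsVars L ↔ ∃ l ∈ L, v ∈ l.vars := by
  induction L with
  | nil => simp [litsVars]
  | cons l L ih =>
    simp only [litsVars, List.foldr_cons, Finset.mem_union] at ih ⊢
    simp [ih]

open Classical in
theorem CondLit.mem_vars {B : CondLit Sym Var} {v : Var} :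
    v ∈ B.vars ↔ v ∈ B.head.vars ∨ ∃ l ∈ B.conds, v ∈ l.vars := by
  simp only [CondLit.vars, Finset.mem_union, mem_litsVars]

open Classical in
theorem CondLit.vars_subst (X : Finset Var) (ρ : Var → Precomputed Sym) (B : CondLit Sym Var) :
    (B.subst X ρ).vars = B.vars \ X := by
  ext v
  simp only [CondLit.mem_vars, Finset.mem_sdiff, CondLit.subst, CondHead.vars_subst, List.mem_map,
    exists_exists_and_eq_and, Lit.vars_subst]
  grind

open Classical in
theorem Rule.mem_globals {R : Rule Sym Var} {v : Var} :
    v ∈ R.globals ↔ v ∈ R.head.vars ∨ ∃ B ∈ R.body, v ∈ B.globals := by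
  have h : ∀ L : List (CondLit Sym Var), v ∈ L.foldr (fun B s => B.globals ∪ s) ∅ ↔
      ∃ B ∈ L, v ∈ B.globals := by
    intro L
    induction L with
    | nil => simp
    | cons B L ih => simp [ih]
  simp only [Rule.globals, Finset.mem_union]
  exact or_congr_right (h _)

open Classical in
/-- Successive substitutions, as a single one. -/
theorem Term.subst_subst (X Y : Finset Var) (ρ ρ' : Var → Precomputed Sym) (t : Term Sym Var) :
    (t.subst X ρ).subst Y ρ' = t.subst (X ∪ Y) (fun v => if v ∈ X then ρ v else ρ' v) := by
  induction t with
  | var v => by_cases h : v ∈ X <;> simp [subst, h]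
  | op o t u ih ih' => simp only [subst, ih, ih']
  | abs t ih => simp only [subst, ih]
  | _ => rfl

open Classical in
theorem Lit.subst_subst (X Y : Finset Var) (ρ ρ' : Var → Precomputed Sym) (l : Lit Sym Var) :
    (l.subst X ρ).subst Y ρ' = l.subst (X ∪ Y) (fun v => if v ∈ X then ρ v else ρ' v) := by
  cases l with
  | basic s a => simp only [Lit.subst, Atom.subst, Term.subst_subst]
  | cmp c t u => simp only [Lit.subst, Term.subst_subst]

open Classical in
theorem CondLit.subst_subst (X Y : Finset Var) (ρ ρ' : Var → Precomputed Sym)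
    (B : CondLit Sym Var) :
    (B.subst X ρ).subst Y ρ' = B.subst (X ∪ Y) (fun v => if v ∈ X then ρ v else ρ' v) := by
  rcases B with ⟨H | _, L⟩ <;> simp [CondLit.subst, CondHead.subst, Lit.subst_subst]

end Substitution

/-! ### Order of numerals and division rounded towards zero -/

namespace TermOrder

variable {Sym Var : Type} (O : TermOrder Sym Var)

theorem holdsOrd_lt_num (m n : ℤ) :
    O.holdsOrd .lt (.num m) (.num n) ↔ m < n :=
  O.num_lt_num m n

/-- The order is total, so `≤` is the negation of the reversed strict order, which is fixed on
numerals by `num_lt_num`. -/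
theorem holdsOrd_le_num (m n : ℤ) :
    O.holdsOrd .le (.num m) (.num n) ↔ m ≤ n := by
  let _ := O.toLinearOrder
  have h := O.num_lt_num n m
  rw [← not_lt, ← h]
  exact (not_lt (α := GroundTerm Sym Var)).symm

theorem holdsOrd_ge_num (m n : ℤ) :
    O.holdsOrd .ge (.num m) (.num n) ↔ n ≤ m :=
  O.holdsOrd_le_num n m

end TermOrder

/-- The quotient of `m` by `n` rounded towards zero, in terms of absolute values. -/
theorem roundZero_div_eq_iff {m n : ℤ} (hn : n ≠ 0) (z : ℤ) :
    z = roundZero ((m : ℚ) / n) ↔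
      ∃ k : ℤ, (k * |n| ≤ |m| ∧ |m| < (k + 1) * |n|) ∧
        ((0 ≤ m * n ∧ z = k) ∨ (m * n < 0 ∧ z = -k)) := by
  have hn' : 0 < (|n| : ℚ) := by exact_mod_cast abs_pos.2 hn
  -- The two inequalities pin `k` down as the floor of `|m / n|`, so the existential quantifier
  -- collapses.
  have key : ∀ k : ℤ, (k * |n| ≤ |m| ∧ |m| < (k + 1) * |n|) ↔ ⌊|(m : ℚ) / n|⌋ = k := by
    intro k
    rw [Int.floor_eq_iff, abs_div, le_div_iff₀ hn', div_lt_iff₀ hn']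
    norm_cast
  simp only [key, exists_eq_left']
  -- Dividing by a square shows that `m / n` has the sign of `m * n`, on which the formula branches.
  -- In the negative case rounding is `⌈x⌉ = -⌊|x|⌋`.
  have hdiv : (m : ℚ) / n = (m * n : ℤ) / (n : ℚ) ^ 2 := by
    have : (n : ℚ) ≠ 0 := by exact_mod_cast hn
    push_cast
    field_simp
  have hsq : 0 < (n : ℚ) ^ 2 := by positivity
  rcases le_or_gt 0 (m * n) with h | h
  · have hq : 0 ≤ (m : ℚ) / n := by
      rw [hdiv]; exact div_nonneg (by exact_mod_cast h) hsq.le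
    simp [roundZero, hq, h, h.not_gt, abs_of_nonneg]
  · have hq : (m : ℚ) / n < 0 := by
      rw [hdiv]; exact div_neg_of_neg_of_pos (by exact_mod_cast h) hsq
    simp [roundZero, hq.not_ge, h, h.not_ge, abs_of_neg hq, Int.floor_neg]

/-- For `n = 0` the bound reads `|m| < 0`. This is how `F₁` excludes division by zero without saying
so. -/
theorem ne_zero_of_lt_mul_abs {m n k : ℤ} (h : |m| < (k + 1) * |n|) : n ≠ 0 := by
  rintro rfl
  simp only [abs_zero, mul_zero] at h
  exact (abs_nonneg m).not_gt h

/-- `roundZero_div_eq_iff`, in the form of the translation of division. -/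
theorem exists_quotient_div_iff {Sym : Type} (m n : ℤ) (r : Precomputed Sym) :
    (∃ k : ℤ, (k * |n| ≤ |m| ∧ |m| < (k + 1) * |n|) ∧
      ((0 ≤ m * n ∧ r = .num k) ∨ (m * n < 0 ∧ r = .num (-k)))) ↔
      n ≠ 0 ∧ r = .num (roundZero ((m : ℚ) / n)) := by
  constructor
  · rintro ⟨k, hk, h⟩
    have hn := ne_zero_of_lt_mul_abs hk.2
    refine ⟨hn, ?_⟩
    rcases h with ⟨h, rfl⟩ | ⟨h, rfl⟩
    · rw [← (roundZero_div_eq_iff hn _).2 ⟨k, hk, .inl ⟨h, rfl⟩⟩]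
    · rw [← (roundZero_div_eq_iff hn _).2 ⟨k, hk, .inr ⟨h, rfl⟩⟩]
  · rintro ⟨hn, rfl⟩
    obtain ⟨k, hk, h⟩ := (roundZero_div_eq_iff hn _).1 rfl
    exact ⟨k, hk, h.imp (.imp_right (congrArg _)) (.imp_right (congrArg _))⟩

/-- The rounded quotient is `k` or `-k` according to the sign of `m * n`; substituting it into `m -
n * q` gives the two branches of `F₃`. -/
theorem exists_quotient_mod_iff {Sym : Type} (m n : ℤ) (r : Precomputed Sym) :
    (∃ k : ℤ, (k * |n| ≤ |m| ∧ |m| < (k + 1) * |n|) ∧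
      ((0 ≤ m * n ∧ r = .num (m - k * n)) ∨ (m * n < 0 ∧ r = .num (m + k * n)))) ↔
      n ≠ 0 ∧ r = .num (m - n * roundZero ((m : ℚ) / n)) := by
  constructor
  · rintro ⟨k, hk, h⟩
    have hn := ne_zero_of_lt_mul_abs hk.2
    refine ⟨hn, ?_⟩
    rcases h with ⟨h, rfl⟩ | ⟨h, rfl⟩
    · rw [← (roundZero_div_eq_iff hn _).2 ⟨k, hk, .inl ⟨h, rfl⟩⟩]
      ring_nf
    · rw [← (roundZero_div_eq_iff hn _).2 ⟨k, hk, .inr ⟨h, rfl⟩⟩]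
      ring_nf
  · rintro ⟨hn, rfl⟩
    obtain ⟨k, hk, h⟩ := (roundZero_div_eq_iff hn _).1 rfl
    refine ⟨k, hk, h.imp (.imp_right fun h => ?_) (.imp_right fun h => ?_)⟩ <;>
    · rw [h]; ring_nf

/-! ### Standard interpretations and the values of terms -/

namespace Interp

variable {Sym Var Q : Type} {ar : Q → ℕ} {O : TermOrder Sym Var}
  {I : Interp Sym ar (Precomputed Sym)}

namespace IsStandard

/-- The numeral of `n`, as an element of the universe of the integer sort. -/
def numeral (hI : I.IsStandard O) (n : ℤ) : I.intUniv :=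
  ⟨.num n, hI.intUniv_eq ▸ Set.mem_range_self n⟩

variable (hI : I.IsStandard O)

@[simp] theorem coe_numeral (n : ℤ) : (hI.numeral n : Precomputed Sym) = .num n := rfl

/-- Turns the quantifiers of `val_t`, which introduce integer variables only existentially, into
quantifiers over `ℤ`. -/
theorem exists_int_iff {p : I.intUniv → Prop} : (∃ d, p d) ↔ ∃ n : ℤ, p (hI.numeral n) := by
  refine ⟨fun ⟨d, h⟩ => ?_, fun ⟨n, h⟩ => ⟨_, h⟩⟩
  obtain ⟨n, hn⟩ := hI.intUniv_eq.subset d.2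
  obtain rfl : hI.numeral n = d := Subtype.ext hn
  exact ⟨n, h⟩

theorem const_num (n : ℤ) : (⟨I.const (.num n), I.const_num_mem n⟩ : I.intUniv) = hI.numeral n :=
  Subtype.ext (hI.const_eq _)

theorem add_numeral (m n : ℤ) :
    I.add (hI.numeral m) (hI.numeral n) = hI.numeral (m + n) :=
  Subtype.ext (hI.add_eq _ _ _ _ rfl rfl)

theorem sub_numeral (m n : ℤ) :
    I.sub (hI.numeral m) (hI.numeral n) = hI.numeral (m - n) :=
  Subtype.ext (hI.sub_eq _ _ _ _ rfl rfl)

theorem mul_numeral (m n : ℤ) :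
    I.mul (hI.numeral m) (hI.numeral n) = hI.numeral (m * n) :=
  Subtype.ext (hI.mul_eq _ _ _ _ rfl rfl)

theorem abs_numeral (n : ℤ) : I.abs (hI.numeral n) = hI.numeral |n| :=
  Subtype.ext (hI.abs_eq _ _ rfl)

end IsStandard

/-- `val_t(Z)` expresses that the value of `Z` is one of the values of `t`. -/
theorem ht_valFml (hI : I.IsStandard O) (V : (q : Q) → (Fin (ar q) → Precomputed Sym) → Prop)
    {X : Finset Var} {ρ : Var → Precomputed Sym} {ep : PVar Var → Precomputed Sym}
    (t : Term Sym Var) (ht : ∀ v ∈ t.vars, v ∈ X ∧ ep (.prog v) = ρ v)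
    (ei : ℕ → I.intUniv) (k : ℕ) (Z : PTm Sym Var)
    (hZ : ∀ ei' : ℕ → I.intUniv, (∀ j < k, ei' j = ei j) → Z.eval I ep ei' = Z.eval I ep ei) :
    I.HT V ep ei (valFml t k Z) ↔ Z.eval I ep ei ∈ (t.subst X ρ).vals := by
  -- The freshness condition `hZ` for the recursive calls: there `Z` is an integer variable whose
  -- number lies below the new bound `k + 1`, `k + 2` or `k + 3`.
  have hvar : ∀ (ei : ℕ → I.intUniv) (k j : ℕ), j < k → ∀ ei' : ℕ → I.intUniv,
      (∀ j < k, ei' j = ei j) → (PTm.int (.ivar j) : PTm Sym Var).eval I ep ei' =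
        (PTm.int (.ivar j)).eval I ep ei :=
    fun ei k j hj ei' h => by simp only [PTm.eval, ITm.eval, h j hj]
  induction t generalizing ei k Z with
  | num n => simp [valFml, HT, Term.subst, Term.vals, PTm.eval, ITm.eval, hI.const_eq]
  | sym c => simp [valFml, HT, Term.subst, Term.vals, PTm.eval, hI.const_eq]
  | inf => simp [valFml, HT, Term.subst, Term.vals, PTm.eval, hI.const_eq]
  | sup => simp [valFml, HT, Term.subst, Term.vals, PTm.eval, hI.const_eq]
  | var v =>
    obtain ⟨hv, hρ⟩ := ht v (by simp [Term.vars])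
    simp [valFml, HT, Term.subst, PTm.eval, hv, hρ]
  | abs t ih =>
    -- The bound variables are numbered `k` and above, so assigning them leaves the value of `Z`
    -- unchanged.
    have hZ1 : ∀ a : I.intUniv, Z.eval I ep (Function.update ei k a) = Z.eval I ep ei :=
      fun a => hZ _ fun j hj => Function.update_of_ne (by omega) _ _
    have ih₁ := fun ei => ih ht ei (k + 1) (.int (.ivar k)) (hvar ei _ _ (by omega))
    simp only [valFml, HT, hI.exists_int_iff, ih₁, hZ1]
    simp [PTm.eval, ITm.eval, hI.abs_numeral, Term.subst, Term.vals]
  | op o t u ih ih' =>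
    have hZ2 : ∀ a b : I.intUniv, Z.eval I ep
        (Function.update (Function.update ei k a) (k + 1) b) = Z.eval I ep ei :=
      fun a b => hZ _ fun j hj => by
        rw [Function.update_of_ne (by omega), Function.update_of_ne (by omega)]
    have hZ3 : ∀ a b c : I.intUniv, Z.eval I ep
        (Function.update (Function.update (Function.update ei k a) (k + 1) b) (k + 2) c) =
          Z.eval I ep ei :=
      fun a b c => hZ _ fun j hj => by
        rw [Function.update_of_ne (by omega), Function.update_of_ne (by omega),
          Function.update_of_ne (by omega)]
    simp only [Term.vars, Finset.mem_union] at ht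
    have ih₂ := fun ei => ih (fun v hv => ht v (.inl hv)) ei (k + 2) (.int (.ivar k))
      (hvar ei _ _ (by omega))
    have ih₃ := fun ei => ih (fun v hv => ht v (.inl hv)) ei (k + 3) (.int (.ivar k))
      (hvar ei _ _ (by omega))
    have ih₂' := fun ei => ih' (fun v hv => ht v (.inr hv)) ei (k + 2) (.int (.ivar (k + 1)))
      (hvar ei _ _ (by omega))
    have ih₃' := fun ei => ih' (fun v hv => ht v (.inr hv)) ei (k + 3) (.int (.ivar (k + 1)))
      (hvar ei _ _ (by omega))
    have hcmp : ∀ (c : OrdRel) (r s : Precomputed Sym), I.cmp c r s = O.holdsOrd c r s :=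
      fun c r s => propext (hI.cmp_iff c r s)
    cases o with
    | add =>
      simp only [valFml, HT, hI.exists_int_iff, ih₂, ih₂', hZ2, Term.subst, Term.vals]
      simp [PTm.eval, ITm.eval, hI.add_numeral, and_comm, and_assoc]
    | sub =>
      simp only [valFml, HT, hI.exists_int_iff, ih₂, ih₂', hZ2, Term.subst, Term.vals]
      simp [PTm.eval, ITm.eval, hI.sub_numeral, and_comm, and_assoc]
    | mul =>
      simp only [valFml, HT, hI.exists_int_iff, ih₂, ih₂', hZ2, Term.subst, Term.vals]
      simp [PTm.eval, ITm.eval, hI.mul_numeral, and_comm, and_assoc]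
    | div =>
      simp only [valFml, quotFml, divFml, HT, hI.exists_int_iff, ih₃, ih₃', hZ3, Term.subst,
        Term.vals, hcmp]
      generalize Z.eval I ep ei = z
      simp [PTm.eval, ITm.eval, hI.mul_numeral, hI.add_numeral, hI.sub_numeral,
        hI.abs_numeral, hI.const_num, O.holdsOrd_lt_num, O.holdsOrd_le_num, O.holdsOrd_ge_num,
        exists_quotient_div_iff]
    | mod =>
      simp only [valFml, quotFml, modFml, HT, hI.exists_int_iff, ih₃, ih₃', hZ3, Term.subst,
        Term.vals, hcmp]
      generalize Z.eval I ep ei = z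
      simp [PTm.eval, ITm.eval, hI.mul_numeral, hI.add_numeral, hI.sub_numeral,
        hI.abs_numeral, hI.const_num, O.holdsOrd_lt_num, O.holdsOrd_le_num, O.holdsOrd_ge_num,
        exists_quotient_mod_iff]
    | interval =>
      simp only [valFml, HT, hI.exists_int_iff, ih₃, ih₃', hZ3, Term.subst, Term.vals, hcmp]
      generalize Z.eval I ep ei = z
      simp only [PTm.eval, ITm.eval, Function.update_self, ne_eq,
        Nat.add_left_cancel_iff, Nat.left_eq_add, one_ne_zero, OfNat.ofNat_ne_zero,
        OfNat.one_ne_ofNat, not_false_eq_true, Function.update_of_ne, hI.coe_numeral,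
        O.holdsOrd_le_num, Set.mem_ofPred_eq]
      constructor
      · rintro ⟨m, n, l, hz, ⟨hl, hl'⟩, hm, hn⟩
        exact ⟨l, m, n, hm, hn, hl, hl', hz⟩
      · rintro ⟨l, m, n, hm, hn, hl, hl', hz⟩
        exact ⟨m, n, l, hz, ⟨hl, hl'⟩, hm, hn⟩

end Interp

/-! ### Sets of atoms and reassignment of variables -/

variable {Sym Var : Type}

/-- The atoms that are true in an interpretation of the predicate symbols in `σ`. -/
def atomsOf {σ : Set (PredSym Sym)}
    (V : (q : σ) → (Fin (sigArity σ q) → Precomputed Sym) → Prop) : Set (PAtom Sym) :=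
  {a | ∃ h : a.pred ∈ σ, V ⟨a.pred, h⟩ a.args}

open Classical in
/-- The assignment `ep`, with the values of the variables in `Z` replaced by those of `ρ`, and the
values of the first `n` fresh variables replaced by `r`. -/
noncomputable def reassign {D : Type} (ep : PVar Var → D) (Z : Finset Var) (ρ : Var → D) {n : ℕ}
    (r : Fin n → D) : PVar Var → D
  | .prog v => if v ∈ Z then ρ v else ep (.prog v)
  | .fresh k => if h : k < n then r ⟨k, h⟩ else ep (.fresh k)

theorem mem_freshVars {n : ℕ} {x : PVar Var} :
    x ∈ freshVars Var n ↔ ∃ k < n, x = .fresh k := by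
  simp only [freshVars, List.mem_ofFn]
  exact ⟨fun ⟨i, hi⟩ => ⟨i, i.2, hi.symm⟩, fun ⟨k, hk, h⟩ => ⟨⟨k, hk⟩, h.symm⟩⟩

theorem reassign_of_notMem {D : Type} (ep : PVar Var → D) (Z : Finset Var) (ρ : Var → D) {n : ℕ}
    (r : Fin n → D) {x : PVar Var} (hx : x ∉ freshVars Var n ++ Z.toList.map .prog) :
    reassign ep Z ρ r x = ep x := by
  simp only [List.mem_append, mem_freshVars, List.mem_map, Finset.mem_toList, not_or] at hx
  cases x with
  | prog v => exact if_neg fun hv => hx.2 ⟨v, hv, rfl⟩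
  | fresh k => exact dif_neg fun hk => hx.1 ⟨k, hk, rfl⟩

theorem reassign_fresh {D : Type} (ep : PVar Var → D) (Z : Finset Var) (ρ : Var → D) {n : ℕ}
    (r : Fin n → D) (i : Fin n) : reassign ep Z ρ r (.fresh i) = r i :=
  dif_pos i.2

/-! ### Agreement of the two translations -/

namespace Interp

section

variable {Q : Type} {ar : Q → ℕ}

/-- Brings a universal closure into the shape of a conjunction over instances: `ρ` is the
substitution for the variables in `Z`, and `r` the tuple of values of the fresh variables `V`. The
equivalence `hΦ` is required for every `ρ` that agrees with the assignment on `Z`, as values of `ρ`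
elsewhere are immaterial. -/
theorem ht_allPs_fresh_prog {D : Type} (I : Interp Sym ar D)
    (V : (q : Q) → (Fin (ar q) → D) → Prop) (ep : PVar Var → D) (ei : ℕ → I.intUniv) (n : ℕ)
    (Z : Finset Var) (F : Fml Sym Var ar) (Φ : (Var → D) → (Fin n → D) → Prop)
    (hΦ : ∀ (ep' : PVar Var → D) (ρ : Var → D), (∀ v ∈ Z, ep' (.prog v) = ρ v) →
      (∀ v ∉ Z, ep' (.prog v) = ep (.prog v)) →
        (I.HT V ep' ei F ↔ Φ ρ fun i => ep' (.fresh i))) :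
    I.HT V ep ei (.allPs (freshVars Var n ++ Z.toList.map .prog) F) ↔ ∀ ρ r, Φ ρ r := by
  rw [ht_allPs]
  constructor
  · intro h ρ r
    have := (hΦ (reassign ep Z ρ r) ρ (fun v hv => if_pos hv) fun v hv => if_neg hv).1
      (h _ fun x hx => reassign_of_notMem ep Z ρ r hx)
    simpa only [reassign_fresh] using this
  · intro h ep' h'
    refine (hΦ ep' (fun v => ep' (.prog v)) (fun _ _ => rfl) fun v hv => h' _ ?_).2 (h _ _)
    simpa [mem_freshVars] using hv

variable {O : TermOrder Sym Var} {I : Interp Sym ar (Precomputed Sym)}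

theorem ht_valTuple (hI : I.IsStandard O) (V : (q : Q) → (Fin (ar q) → Precomputed Sym) → Prop)
    {X : Finset Var} {ρ : Var → Precomputed Sym} {ep : PVar Var → Precomputed Sym} {n : ℕ}
    (t : Fin n → Term Sym Var) (ht : ∀ i, ∀ v ∈ (t i).vars, v ∈ X ∧ ep (.prog v) = ρ v)
    (ei : ℕ → I.intUniv) :
    I.HT V ep ei (valTuple t) ↔
      (fun i : Fin n => ep (.fresh i)) ∈ tupleVals fun i => (t i).subst X ρ := by
  simp only [valTuple, ht_conj, List.forall_mem_ofFn_iff]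
  exact forall_congr' fun i => ht_valFml hI V (t i) (ht i) ei 0 _ fun _ _ => rfl

theorem ht_rel (hI : I.IsStandard O) (V : (q : Q) → (Fin (ar q) → Precomputed Sym) → Prop)
    (ep : PVar Var → Precomputed Sym) (ei : ℕ → I.intUniv) (c : Rel) (s t : PTm Sym Var) :
    I.HT V ep ei (.rel c s t) ↔ O.holds c (s.eval I ep ei) (t.eval I ep ei) := by
  cases c with
  | eq => rfl
  | ne => simp only [Fml.rel, ht_neg, HT, and_self]; rfl
  | ord c => exact hI.cmp_iff c _ _

end

variable {σ : Set (PredSym Sym)} {O : TermOrder Sym Var}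
  {I : Interp Sym (sigArity σ) (Precomputed Sym)}

theorem ht_freshAtom (V : (q : σ) → (Fin (sigArity σ q) → Precomputed Sym) → Prop)
    (ep : PVar Var → Precomputed Sym) (ei : ℕ → I.intUniv) (q : PredSym Sym) (h : q ∈ σ) :
    I.HT V ep ei (freshAtom σ q h) ↔
      (IFml.atom ⟨q, fun i => ep (.fresh i)⟩).HTSat (atomsOf V) I.atoms :=
  ⟨fun hV => ⟨h, hV⟩, fun ⟨_, hV⟩ => hV⟩

theorem ht_sign_freshAtom (V : (q : σ) → (Fin (sigArity σ q) → Precomputed Sym) → Prop)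
    (ep : PVar Var → Precomputed Sym) (ei : ℕ → I.intUniv) (s : Sign) (q : PredSym Sym)
    (h : q ∈ σ) :
    I.HT V ep ei (s.toFml (freshAtom σ q h)) ↔
      (s.toIFml (.atom ⟨q, fun i => ep (.fresh i)⟩)).HTSat (atomsOf V) I.atoms := by
  have hI := ht_freshAtom I.pred ep ei q h
  have hV := ht_freshAtom V ep ei q h
  rw [show atomsOf I.pred = I.atoms from rfl] at hI
  cases s with
  | pos => exact hV
  | neg => simp only [Sign.toFml, Sign.toIFml, ht_neg, IFml.htSat_neg, hI, hV]
  | negneg => simp only [Sign.toFml, Sign.toIFml, ht_neg, IFml.htSat_neg, hI, hV]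

-- For a basic literal, choosing `V` with `val_t(V)` amounts to choosing a disjunct `r ∈ [t]`. A
-- comparison contains no predicate symbols from `σ`, so its truth does not depend on `V` and both
-- sides collapse to a truth value.
open Classical in
theorem ht_lit_tauB (hI : I.IsStandard O)
    (V : (q : σ) → (Fin (sigArity σ q) → Precomputed Sym) → Prop)
    {X : Finset Var} {ρ : Var → Precomputed Sym} {ep : PVar Var → Precomputed Sym}
    (l : Lit Sym Var) (h : l.preds ⊆ σ) (hl : ∀ v ∈ l.vars, v ∈ X ∧ ep (.prog v) = ρ v)
    (ei : ℕ → I.intUniv) :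
    I.HT V ep ei (l.tauB σ h) ↔ ((l.subst X ρ).tau O).HTSat (atomsOf V) I.atoms := by
  cases l with
  | basic s a =>
    have hval : ∀ ep' : PVar Var → Precomputed Sym, (∀ v, ep' (.prog v) = ep (.prog v)) →
        (I.HT V ep' ei (valTuple a.args) ↔
          (fun i : Fin a.pred.arity => ep' (.fresh i)) ∈
            tupleVals fun i => (a.args i).subst X ρ) := fun ep' h' =>
      ht_valTuple hI V a.args (fun i v hv =>
        (hl v (Atom.mem_vars.2 ⟨i, hv⟩)).imp_right (h' v).trans) ei
    simp only [Lit.tauB, ht_exPs, HT, Lit.subst, Lit.tau, IFml.HTSat, ht_sign_freshAtom]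
    constructor
    · rintro ⟨ep', h', hv, hs⟩
      refine ⟨⟨_, (hval ep' fun v => h' _ ?_).1 hv⟩, hs⟩
      simp [mem_freshVars]
    · rintro ⟨⟨(r : Fin a.pred.arity → Precomputed Sym), hr⟩, hs⟩
      -- With `∅` as the set of program variables, `reassign` changes only the fresh variables,
      -- giving them the values `r`.
      have hr' : (fun i : Fin a.pred.arity => reassign ep ∅ ρ r (.fresh i)) = r :=
        funext fun i => reassign_fresh ep ∅ ρ r i
      refine ⟨reassign ep ∅ ρ r, fun x hx => reassign_of_notMem _ _ _ _ (by simpa using hx),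
        (hval _ fun v => by simp [reassign]).2 ?_, ?_⟩
      · rw [hr']; exact hr
      · rw [hr']; exact hs
  | cmp c t u =>
    simp only [Lit.vars, Finset.mem_union] at hl
    have hval : ∀ (t : Term Sym Var) (d e : Precomputed Sym) (j : ℕ),
        (∀ v ∈ t.vars, v ∈ X ∧ ep (.prog v) = ρ v) →
        (I.HT V (Function.update (Function.update ep (.fresh 0) d) (.fresh 1) e) ei
          (valFml t 0 (.pvar (.fresh j))) ↔
            Function.update (Function.update ep (.fresh 0) d) (.fresh 1) e (.fresh j) ∈
              (t.subst X ρ).vals) := fun t d e j ht =>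
      ht_valFml hI V t (fun v hv => (ht v hv).imp_right fun h => by simpa using h) ei 0 _
        fun _ _ => rfl
    simp only [Lit.tauB, HT, Lit.subst, Lit.tau, ht_rel hI, hval t _ _ _ fun v hv => hl v (.inl hv),
      hval u _ _ _ fun v hv => hl v (.inr hv)]
    split_ifs with hc
    · simp only [IFml.htSat_top, iff_true]
      obtain ⟨r, hr, s, hs, h⟩ := hc
      exact ⟨r, s, by simpa [PTm.eval] using ⟨hr, hs, h⟩⟩
    · simp only [IFml.not_htSat_bot, iff_false]
      rintro ⟨r, s, h⟩
      simp only [PTm.eval, Function.update_self, ne_eq, PVar.fresh.injEq, zero_ne_one,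
        not_false_eq_true, Function.update_of_ne] at h
      exact hc ⟨r, h.1, s, h.2⟩

theorem ht_condHead_tauB (hI : I.IsStandard O)
    (V : (q : σ) → (Fin (sigArity σ q) → Precomputed Sym) → Prop)
    {X : Finset Var} {ρ : Var → Precomputed Sym} {ep : PVar Var → Precomputed Sym}
    (H : CondHead Sym Var) (h : H.preds ⊆ σ) (hH : ∀ v ∈ H.vars, v ∈ X ∧ ep (.prog v) = ρ v)
    (ei : ℕ → I.intUniv) :
    I.HT V ep ei (H.tauB σ h) ↔ ((H.subst X ρ).tau O).HTSat (atomsOf V) I.atoms := by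
  cases H with
  | lit l => exact ht_lit_tauB hI V l h hH ei
  | bot => exact iff_of_false id (IFml.not_htSat_bot _ _)

theorem ht_litsTauB (hI : I.IsStandard O)
    (V : (q : σ) → (Fin (sigArity σ q) → Precomputed Sym) → Prop)
    {X : Finset Var} {ρ : Var → Precomputed Sym} {ep : PVar Var → Precomputed Sym}
    (L : List (Lit Sym Var)) (h : ∀ l ∈ L, l.preds ⊆ σ)
    (hL : ∀ l ∈ L, ∀ v ∈ l.vars, v ∈ X ∧ ep (.prog v) = ρ v) (ei : ℕ → I.intUniv) :
    I.HT V ep ei (litsTauB σ L h) ↔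
      (litsTau O (L.map fun l => l.subst X ρ)).HTSat (atomsOf V) I.atoms := by
  simp only [litsTauB, ht_conj, litsTau, IFml.htSat_conjList, List.mem_pmap, List.mem_map,
    forall_exists_index, and_imp, forall_apply_eq_imp_iff₂]
  constructor
  · exact fun H l hl => (ht_lit_tauB hI V l (h l hl) (hL l hl) ei).1 (H _ l hl rfl)
  · rintro H _ l hl rfl
    exact (ht_lit_tauB hI V l (h l hl) (hL l hl) ei).2 (H l hl)

-- Instantiating the rule fixes the variables in `Z`; those left in the instance are exactly the
-- ones bound by `∀X`. The two successive substitutions in `τ` merge into one, equal to `ρ` on `Z`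
-- and to the values of `X` elsewhere. If there are no conditions, all variables of the head are
-- global, hence in `Z`.
open Classical in
theorem ht_condLit_tauB (hI : I.IsStandard O)
    (V : (q : σ) → (Fin (sigArity σ q) → Precomputed Sym) → Prop)
    {Z : Finset Var} {ρ : Var → Precomputed Sym} {ep : PVar Var → Precomputed Sym}
    (B : CondLit Sym Var) (h : B.preds ⊆ σ) (hB : B.globals ⊆ Z)
    (hρ : ∀ v ∈ Z, ep (.prog v) = ρ v) (ei : ℕ → I.intUniv) :
    I.HT V ep ei (B.tauB σ Z h) ↔ ((B.subst Z ρ).tau O).HTSat (atomsOf V) I.atoms := by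
  by_cases hc : B.conds = []
  · have hc' : (B.subst Z ρ).conds = [] := by simp [CondLit.subst, hc]
    rw [CondLit.tauB, if_pos hc, CondLit.tau, if_pos hc']
    refine ht_condHead_tauB hI V B.head _ (fun v hv => ?_) ei
    have hv : v ∈ Z := hB (by simpa [CondLit.globals, hc, litsVars] using hv)
    exact ⟨hv, hρ v hv⟩
  · have hc' : (B.subst Z ρ).conds ≠ [] := by simp [CondLit.subst, hc]
    rw [CondLit.tauB, if_neg hc, CondLit.tau, if_neg hc']
    simp only [CondLit.subst_subst, CondLit.vars_subst]
    -- There are no fresh variables in this block (`n = 0`), so the quantifier over `r` is vacuous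
    -- and is removed at the end.
    refine (ht_allPs_fresh_prog I V ep ei 0 (B.vars \ Z) _ (fun ρ' _ =>
      (IFml.imp (litsTau O (B.subst (Z ∪ B.vars \ Z) fun v => if v ∈ Z then ρ v else ρ' v).conds)
        ((B.subst (Z ∪ B.vars \ Z) fun v => if v ∈ Z then ρ v else ρ' v).head.tau O)).HTSat
          (atomsOf V) I.atoms) ?_).trans (forall_congr' fun ρ' => forall_const _)
    intro ep' ρ' h₁ h₂
    have hvars : ∀ v ∈ B.vars, v ∈ Z ∪ B.vars \ Z ∧
        ep' (.prog v) = if v ∈ Z then ρ v else ρ' v := by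
      intro v hv
      by_cases hvZ : v ∈ Z
      · simp [hvZ, h₂, hρ]
      · simp [hvZ, h₁, hv]
    -- Stated for every `W`, because the implication needs it both for `V` and for `I.pred`.
    have hlits := fun W h => ht_litsTauB (σ := σ) hI W B.conds h
      (fun l hl v hv => hvars v (CondLit.mem_vars.2 (.inr ⟨l, hl, hv⟩))) ei
    have hhead := fun W h => ht_condHead_tauB (σ := σ) hI W B.head h
      (fun v hv => hvars v (CondLit.mem_vars.2 (.inl hv))) ei
    rw [ht_imp, IFml.htSat_imp]
    exact and_congr (imp_congr (hlits _ _) (hhead _ _)) (imp_congr (hlits _ _) (hhead _ _))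

theorem ht_tauBody (hI : I.IsStandard O)
    (V : (q : σ) → (Fin (sigArity σ q) → Precomputed Sym) → Prop)
    {ρ : Var → Precomputed Sym} {ep : PVar Var → Precomputed Sym}
    (R : Rule Sym Var) (h : R.preds ⊆ σ) (hρ : ∀ v ∈ R.globals, ep (.prog v) = ρ v)
    (ei : ℕ → I.intUniv) :
    I.HT V ep ei (R.tauBody σ h) ↔
      (bodyTau O (R.body.map fun B => B.subst R.globals ρ)).HTSat (atomsOf V) I.atoms := by
  have hB : ∀ B ∈ R.body, ∀ h, I.HT V ep ei (B.tauB σ R.globals h) ↔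
      ((B.subst R.globals ρ).tau O).HTSat (atomsOf V) I.atoms := fun B hB h =>
    ht_condLit_tauB hI V B h (fun v hv => Rule.mem_globals.2 (.inr ⟨B, hB, hv⟩)) hρ ei
  simp only [Rule.tauBody, ht_conj, bodyTau, IFml.htSat_conjList, List.forall_mem_map]
  constructor
  · exact fun H B hBR => (hB B hBR _).1 (H _ (List.mem_pmap.2 ⟨B, hBR, rfl⟩))
  · intro H _ hF
    obtain ⟨B, hBR, rfl⟩ := List.mem_pmap.1 hF
    exact (hB B hBR _).2 (H B hBR)

/-- `τ*R` and `τR` have the same HT-models. -/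
theorem ht_tauStar (hI : I.IsStandard O)
    (V : (q : σ) → (Fin (sigArity σ q) → Precomputed Sym) → Prop)
    (hV : atomsOf V ⊆ I.atoms) (R : Rule Sym Var) (h : R.preds ⊆ σ)
    (ep : PVar Var → Precomputed Sym) (ei : ℕ → I.intUniv) :
    I.HT V ep ei (R.tauStar σ h) ↔ (R.tau O).HTSat (atomsOf V) I.atoms := by
  have hself : atomsOf I.pred = I.atoms := rfl
  rcases R with ⟨a | a | _, Bs⟩
  · refine (ht_allPs_fresh_prog I V ep ei a.pred.arity (Rule.mk (.basic a) Bs).globals _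
      (fun ρ r => r ∈ tupleVals (fun i => (a.args i).subst (Rule.mk (.basic a) Bs).globals ρ) →
        (IFml.imp (bodyTau O (Bs.map fun B => B.subst (Rule.mk (.basic a) Bs).globals ρ))
          (.atom ⟨a.pred, r⟩)).HTSat (atomsOf V) I.atoms) ?_).trans ?_
    · intro ep' ρ h₁ _
      -- The right-hand side does not depend on `W`: membership in `[t]` is the same in both worlds,
      -- so it can be taken out of the implication as a premise.
      have hval := fun W => ht_valTuple hI W a.args (fun i v hv => by
        have : v ∈ (Rule.mk (.basic a) Bs).globals :=
          Rule.mem_globals.2 (.inl (Atom.mem_vars.2 ⟨i, hv⟩))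
        exact ⟨this, h₁ v this⟩) ei
      have hbody := fun W => ht_tauBody hI W (Rule.mk (.basic a) Bs) h h₁ ei
      rw [ht_imp]
      simp only [IFml.htSat_imp, HT, hval, hbody, ht_freshAtom, hself]
      tauto
    · refine forall_congr' fun ρ => ?_
      simp only [Rule.inst, Rule.subst, RuleHead.subst, Rule.tauClosed, Atom.subst,
        IFml.htSat_imp_conj, Subtype.forall]
  · refine (ht_allPs_fresh_prog I V ep ei a.pred.arity (Rule.mk (.choice a) Bs).globals _
      (fun ρ r => r ∈ tupleVals (fun i => (a.args i).subst (Rule.mk (.choice a) Bs).globals ρ) →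
        (IFml.imp (bodyTau O (Bs.map fun B => B.subst (Rule.mk (.choice a) Bs).globals ρ))
          (.or (.atom ⟨a.pred, r⟩) (.neg (.atom ⟨a.pred, r⟩)))).HTSat (atomsOf V) I.atoms) ?_).trans ?_
    · intro ep' ρ h₁ _
      have hval := fun W => ht_valTuple hI W a.args (fun i v hv => by
        have : v ∈ (Rule.mk (.choice a) Bs).globals :=
          Rule.mem_globals.2 (.inl (Atom.mem_vars.2 ⟨i, hv⟩))
        exact ⟨this, h₁ v this⟩) ei
      have hbody := fun W => ht_tauBody hI W (Rule.mk (.choice a) Bs) h h₁ ei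
      rw [ht_imp]
      -- The premise `¬¬p(r)` holds iff `p(r)` is true there, and `p(r) ∨ ¬p(r)` holds iff `p(r)` is
      -- true here or false there. Both forms thus say that if the body holds here and `p(r)` there,
      -- then `p(r)` holds here; the condition at the world of there is trivial.
      simp only [ht_neg, IFml.htSat_imp, IFml.htSat_or, IFml.htSat_neg, HT, hval, hbody, ht_freshAtom, hself]
      have := @hV ⟨a.pred, fun i => ep' (.fresh i)⟩
      simp only [IFml.HTSat]
      tauto
    · refine forall_congr' fun ρ => ?_
      simp only [Rule.inst, Rule.subst, RuleHead.subst, Rule.tauClosed, Atom.subst,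
        IFml.htSat_imp_conj, Subtype.forall]
  · refine (ht_allPs_fresh_prog I V ep ei 0 (Rule.mk .bot Bs).globals _ (fun ρ _ =>
      (IFml.neg (bodyTau O (Bs.map fun B => B.subst (Rule.mk .bot Bs).globals ρ))).HTSat
          (atomsOf V) I.atoms) ?_).trans (forall_congr' fun ρ => forall_const _)
    intro ep' ρ h₁ _
    have hbody := fun W => ht_tauBody hI W (Rule.mk .bot Bs) h h₁ ei
    rw [ht_imp]
    simp only [IFml.htSat_neg, HT, hbody, hself, imp_false]

theorem ht_program_tauStar {P : Program Sym Var} {I : Program.Interp P} (hI : I.IsStandard O)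
    (V : (q : Program.preds P) → (Fin (sigArity (Program.preds P) q) → Precomputed Sym) → Prop)
    (hV : atomsOf V ⊆ I.atoms) (ep : PVar Var → Precomputed Sym) (ei : ℕ → I.intUniv) :
    I.HT V ep ei (.conj (Program.tauStar P)) ↔
      IFml.HTModel (atomsOf V) I.atoms (Program.tau O P) := by
  simp only [ht_conj, Program.tauStar, List.forall_mem_map, Finset.mem_toList, IFml.HTModel]
  constructor
  · rintro H _ ⟨R, hR, rfl⟩
    exact (ht_tauStar hI V hV R _ ep ei).1 (H ⟨R, hR⟩ (Finset.mem_attach _ _))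
  · exact fun H R _ => (ht_tauStar hI V hV R.1 _ ep ei).2 (H _ ⟨R, R.2, rfl⟩)

end Interp

/-! ### Comparison of the minimality conditions -/

theorem exists_atomsOf_eq {σ : Set (PredSym Sym)} {S : Set (PAtom Sym)}
    (hS : ∀ a ∈ S, a.pred ∈ σ) :
    ∃ V : (q : σ) → (Fin (sigArity σ q) → Precomputed Sym) → Prop, atomsOf V = S :=
  ⟨fun q w => ⟨q.1, w⟩ ∈ S, Set.ext fun a => ⟨fun ⟨_, h⟩ => h, fun h => ⟨hS a h, h⟩⟩⟩

theorem atomsOf_subset_iff {σ : Set (PredSym Sym)}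
    {V W : (q : σ) → (Fin (sigArity σ q) → Precomputed Sym) → Prop} :
    atomsOf V ⊆ atomsOf W ↔ ∀ q w, V q w → W q w := by
  constructor
  · intro h q w hV
    obtain ⟨_, hW⟩ := @h ⟨q.1, w⟩ ⟨q.2, hV⟩
    exact hW
  · rintro h a ⟨ha, hV⟩
    exact ⟨ha, h _ _ hV⟩

/-- Passing to the set of true atoms preserves and reflects inclusion, hence also strict inclusion.
-/
theorem Interp.predLT_univ_iff {σ : Set (PredSym Sym)}
    (I : Interp Sym (sigArity σ) (Precomputed Sym))
    (U : PredAssign (sigArity σ) Set.univ (Precomputed Sym)) :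
    I.PredLT Set.univ U ↔ atomsOf (fun q => U ⟨q, trivial⟩) ⊂ I.atoms := by
  rw [ssubset_iff_subset_not_subset, show I.atoms = atomsOf I.pred from rfl, atomsOf_subset_iff,
    atomsOf_subset_iff]
  simp only [PredLT, Subtype.forall, Set.mem_univ, forall_true_left]

end CondASP

theorem theorem2 {Sym Var : Type} (O : TermOrder Sym Var) (P : Program Sym Var)
    (I : Program.Interp P) (hI : I.IsStandard O) :
    Program.IsAnswerSet P I ↔ Program.IsGringoAnswerSet O P I.atoms := by
  have hmodels : I.Models (.conj (Program.tauStar P)) ↔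
      IFml.HTModel I.atoms I.atoms (Program.tau O P) := by
    have key := Interp.ht_program_tauStar hI I.pred subset_rfl
    simp only [Interp.ht_self] at key
    -- The propositional side does not depend on the assignment, so one assignment suffices; `inf`
    -- and the numeral 0 serve as arbitrary values of the two sorts.
    exact ⟨fun h => (key _ _).1 (h (fun _ => .inf) fun _ => hI.numeral 0),
      fun h ep ei => (key ep ei).2 h⟩
  have hstar : ∀ U, I.PredLT Set.univ U → ((I.extend Set.univ U).Models
      (Fml.star Set.univ (.conj (Program.tauStar P))) ↔
        IFml.HTModel (atomsOf fun q => U ⟨q, trivial⟩) I.atoms (Program.tau O P)) := by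
    intro U hU
    have key := Interp.ht_program_tauStar hI (fun q => U ⟨q, trivial⟩)
      ((I.predLT_univ_iff U).1 hU).subset
    exact ⟨fun h => (key _ _).1 ((I.sat_star_univ U _ _ _).1
      (h (fun _ => .inf) fun _ => hI.numeral 0)),
      fun h ep ei => (I.sat_star_univ U _ _ _).2 ((key ep ei).2 h)⟩
  refine and_congr hmodels ?_
  simp only [not_exists, not_and]
  constructor
  · intro h S hS hmod
    -- Every atom of a subset of `A(I)` has its predicate symbol in the signature, so the subset is
    -- the extension of some values of the predicate variables.
    obtain ⟨V, rfl⟩ := exists_atomsOf_eq fun a ha => (hS.subset ha).1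
    have hlt := (I.predLT_univ_iff fun q => V q.1).2 hS
    exact h _ hlt ((hstar _ hlt).2 hmod)
  · exact fun h U hU hmod => h _ ((I.predLT_univ_iff U).1 hU) ((hstar U hU).1 hmod)
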